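/- Let $G=(V,E)$ be a 3-connected simple graph with bounded vertex degree which is transient for simple random walk, and let $P=(P_v)_{v\in V}$ be a circle packing of $G$ in the hyperbolic plane $\mathbb H^2$, realised as the open unit disc of $\mathbb C$: the $P_v$ are closed discs in the open unit disc with pairwise disjoint interiors, $P_u$ and $P_v$ ($u\ne v$) are tangent if and only if $uv\in E$ (so $G$ is planar), and every compact subset of the open unit disc meets only finitely many of the discs. Let $r_v$ be the Euclidean radius of $P_v$, and let $m(uv)=r_u+r_v$ for $uv\in E$. Let $C:E\to(0,\infty)$ be conductances with $\sup_{e\in E}C(e)<\infty$, and fix $b_0\in V$. Paths are sequences $\gamma=(\gamma(0),\gamma(1),\dots)$ of vertices with $\gamma(n)\gamma(n+1)\in E$ for all $n$. For $q:E\to(0,\infty)$, the $q$-length of $\gamma$ is the sum of $q(e)$ over the edges $e$ of $\gamma$, each counted once. For $v\in V$ and $z\in\partial\mathbb H^2$ (the unit circle), $d_m(v,z)\in[0,\infty]$ is the infimum of the $m$-lengths of the paths from $v$ along which the disc centres converge to $z$. A set $W\subset V$ is a neighbourhood of $z$ if it contains $\{v\in V: d_m(v,z)<r\}$ for some $r>0$.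 A property holds for almost every path of a family if the subfamily $\Gamma$ of exceptions has infinite extremal length $$\sup\Big\{\frac{\big(\inf_{\gamma\in\Gamma}\text{$q$-length of }\gamma\big)^2}{\sum_{e\in E}C(e)q(e)^2}\;:\; q:E\to(0,\infty),\ \sum_{e\in E}C(e)q(e)^2<\infty\Big\}.$$ For $f:V\to\mathbb R$ and a directed edge $(u,v)$ let $\nabla f(u,v)=C(uv)(f(v)-f(u))$, and let $\mathcal E(\nabla f)=\sum_{uv\in E}C(uv)(f(u)-f(v))^2$. The function $f$ is Dirichlet if $\mathcal E(\nabla f)<\infty$, and harmonic if $f(v)=\sum_{w\sim v}C(vw)f(w)\big/\sum_{w\sim v}C(vw)$ for every $v\in V$. Let $A$ be a nonempty proper closed subset of $\partial\mathbb H^2$. Let $\mathcal R_A$ be the set of harmonic Dirichlet functions that lie in the closure, with respect to the norm $\|u\|=\sqrt{\mathcal E(\nabla u)+|u(b_0)|^2}$, of the set of Dirichlet functions $g$ such that every $z\in A$ has a neighbourhood on which $g$ vanishes; let $\mathcal S_A=\{\nabla f:f\in\mathcal R_A\}$. Suppose that there is a set $W\subset V$ which is a neighbourhood of every $z\in A$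 and such that the network $G\setminus W$ (the subgraph of $G$ induced by $V\setminus W$, with the conductances $C$) is transient, i.e. the random walk with conductances $C$ on at least one of its connected components is transient. Then there is a nonconstant harmonic Dirichlet function $f:V\to\mathbb R$ with $\nabla f\in\mathcal S_A$; moreover $f$ can be chosen in $\mathcal R_A$ itself and such that, for almost every path $\gamma$ with $d_m(\gamma(n),z)\to0$ for some $z\in A$, one has $f(\gamma(n))\to0$. -/

import Mathlib

open scoped ENNReal Topology

noncomputable section

namespace CirclePackedNetwork

universe u

variable {V : Type u}

/-- A graph with more than three vertices is 3-connected when it stays connected after the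
deletion of any two (not necessarily distinct) vertices. -/
def IsThreeConnected (G : SimpleGraph V) : Prop :=
  4 ≤ ENat.card V ∧ ∀ u v : V, (G.induce ({u, v}ᶜ : Set V)).Connected

/-! ### Random walk on a network

A network is a graph together with a conductance function. Conductances are given on `Sym2 V`; only
their values on the edges of the graph are ever used. -/

/-- One-step transition probabilities of the random walk on the network `(G, C)`:
`p(x,y) = C(xy) / ∑_z C(xz)`. -/
def transitionProb (G : SimpleGraph V) (C : Sym2 V → ℝ) (x y : V) : ℝ≥0∞ :=
  open Classical in
  if G.Adj x y then
    ENNReal.ofReal (C s(x, y)) / ∑' z : G.neighborSet x, ENNReal.ofReal (C s(x, (z : V)))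
  else 0

/-- `n`-step transition probabilities `pₙ(x,y)`. -/
def stepProb (G : SimpleGraph V) (C : Sym2 V → ℝ) : ℕ → V → V → ℝ≥0∞
  | 0, x, y => open Classical in if x = y then 1 else 0
  | n + 1, x, y => ∑' z : V, transitionProb G C x z * stepProb G C n z y

/-- The network `(G, C)`, which need not be connected, is transient when the random walk in one of
its components is: the expected number `∑ₙ pₙ(x,x)` of visits to some starting point `x` is finite.
(An isolated vertex, at which the walk cannot move, does not count.) -/
def IsTransient (G : SimpleGraph V) (C : Sym2 V → ℝ) : Prop :=
  ∃ x : V, (∃ y, G.Adj x y) ∧ ∑' n : ℕ, stepProb G C n x x < ⊤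

/-- The network obtained from `(G, C)` by deleting the vertices in `W` (and all edges at them) is
transient. -/
def IsTransientOff (G : SimpleGraph V) (C : Sym2 V → ℝ) (W : Set V) : Prop :=
  IsTransient (G.induce Wᶜ) (fun e => C (e.map Subtype.val))

/-! ### Gradient, energy, harmonic Dirichlet functions -/

/-- The gradient `∇F(e) = C(e) (F(head) - F(tail))`, a function on directed edges. -/
def gradient (G : SimpleGraph V) (C : Sym2 V → ℝ) (F : V → ℝ) : G.Dart → ℝ :=
  fun d => C d.edge * (F d.snd - F d.fst)

/-- The energy `½ ∑ R(e) θ(e)²` over directed edges, with `R = 1 / C`. -/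
def energy (G : SimpleGraph V) (C : Sym2 V → ℝ) (θ : G.Dart → ℝ) : ℝ≥0∞ :=
  (1 / 2) * ∑' d : G.Dart, ENNReal.ofReal (θ d ^ 2 / C d.edge)

/-- Functions of finite Dirichlet energy. -/
def IsDirichlet (G : SimpleGraph V) (C : Sym2 V → ℝ) (f : V → ℝ) : Prop :=
  energy G C (gradient G C f) < ⊤

/-- `f` equals its weighted average over the neighbours, at every vertex. -/
def IsHarmonic (G : SimpleGraph V) [G.LocallyFinite] (C : Sym2 V → ℝ) (f : V → ℝ) : Prop :=
  ∀ v : V, f v = ∑ w ∈ G.neighborFinset v,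
    C s(v, w) * f w / ∑ w' ∈ G.neighborFinset v, C s(v, w')

/-- The norm `√(ℰ(∇u) + |u(b₀)|²)`, as an extended real. -/
def dirichletNorm (G : SimpleGraph V) (C : Sym2 V → ℝ) (b₀ : V) (u : V → ℝ) : ℝ≥0∞ :=
  (energy G C (gradient G C u) + ENNReal.ofReal (|u b₀| ^ 2)) ^ (1 / 2 : ℝ)

/-! ### Infinite paths and extremal length -/

/-- Singly infinite paths. Repeated vertices are allowed. -/
structure InfinitePath (G : SimpleGraph V) where
  vertex : ℕ → V
  adj : ∀ n, G.Adj (vertex n) (vertex (n + 1))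

/-- The set of edges of a path. -/
def InfinitePath.edges {G : SimpleGraph V} (γ : InfinitePath G) : Set (Sym2 V) :=
  Set.range fun n => s(γ.vertex n, γ.vertex (n + 1))

/-- The `q`-length of a path: the sum of `q(e)` over the edges `e` of the path. -/
def pathLength {G : SimpleGraph V} (q : Sym2 V → ℝ) (γ : InfinitePath G) : ℝ≥0∞ :=
  ∑' e : γ.edges, ENNReal.ofReal (q e)

/-- `‖q‖² = ∑ C(e) q(e)²`, over the undirected edges. -/
def metricNormSq (G : SimpleGraph V) (C : Sym2 V → ℝ) (q : Sym2 V → ℝ) : ℝ≥0∞ :=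
  ∑' e : G.edgeSet, ENNReal.ofReal (C e * q e ^ 2)

/-- Extremal length: the supremum, over the positive `L²` metrics `q`, of
`(inf over γ ∈ Γ of the q-length of γ)² / ‖q‖²`. -/
def extremalLength (G : SimpleGraph V) (C : Sym2 V → ℝ) (Γ : Set (InfinitePath G)) : ℝ≥0∞ :=
  ⨆ (q : Sym2 V → ℝ) (_ : ∀ e ∈ G.edgeSet, 0 < q e) (_ : metricNormSq G C q < ⊤),
    (⨅ γ ∈ Γ, pathLength q γ) ^ 2 / metricNormSq G C q

/-- `p` holds for almost every path of the family `Γ`: the exceptional subfamily has infinite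
extremal length. -/
def ForAlmostEveryPath (G : SimpleGraph V) (C : Sym2 V → ℝ) (Γ : Set (InfinitePath G))
    (p : InfinitePath G → Prop) : Prop :=
  extremalLength G C {γ ∈ Γ | ¬ p γ} = ⊤

/-! ### Circle packings in the hyperbolic plane -/

/-- A circle packing in the Poincaré unit disc, indexed by `V`, whose nerve is `G`: discs in the
open unit disc with disjoint interiors, two of them being tangent exactly when their vertices are
adjacent, and only finitely many of them meeting any compact subset of the open unit disc.
Hyperbolic discs are Euclidean discs; `center` and `radius` are the Euclidean ones. -/
structure HyperbolicCirclePacking (G : SimpleGraph V) where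
  center : V → ℂ
  radius : V → ℝ
  radius_pos : ∀ v, 0 < radius v
  subset_disc : ∀ v, Metric.closedBall (center v) (radius v) ⊆ Metric.ball (0 : ℂ) 1
  disjoint_interiors : ∀ v w, v ≠ w →
    Disjoint (Metric.ball (center v) (radius v)) (Metric.ball (center w) (radius w))
  nerve : ∀ v w, v ≠ w → (G.Adj v w ↔ dist (center v) (center w) = radius v + radius w)
  locally_finite : ∀ K : Set ℂ, IsCompact K → K ⊆ Metric.ball (0 : ℂ) 1 →
    {v | (Metric.closedBall (center v) (radius v) ∩ K).Nonempty}.Finite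

namespace HyperbolicCirclePacking

variable {G : SimpleGraph V} (P : HyperbolicCirclePacking G)

/-- The edge metric `m(uv) = r_u + r_v`. -/
def m : Sym2 V → ℝ :=
  Sym2.lift ⟨fun u v => P.radius u + P.radius v, fun u v => add_comm (P.radius u) (P.radius v)⟩

/-- The path distance `d_m(v,z)` from a vertex `v` to a point `z` of `∂ℍ²` (the unit circle): the
infimum of the `m`-lengths of the paths that start at `v` and converge to `z`
(`∞` if there are none of finite length). -/
def distBoundary (v : V) (z : Circle) : ℝ≥0∞ :=
  ⨅ (γ : InfinitePath G) (_ : γ.vertex 0 = v)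
    (_ : Filter.Tendsto (fun n => P.center (γ.vertex n)) Filter.atTop (𝓝 (z : ℂ))),
    pathLength P.m γ

/-- `W` is the set of vertices in a neighbourhood of `z ∈ ∂ℍ²`, for the topology induced by `m`. -/
def IsNbhd (z : Circle) (W : Set V) : Prop :=
  ∃ r : ℝ≥0∞, 0 < r ∧ ∀ v, P.distBoundary v z < r → v ∈ W

/-- `f` vanishes near every point of `A`. -/
def VanishesNear (A : Set Circle) (f : V → ℝ) : Prop :=
  ∀ z ∈ A, ∃ W : Set V, P.IsNbhd z W ∧ Function.support f ∩ W = ∅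

/-- The space `R_A` of the harmonic Dirichlet functions that lie in the closure, in the norm
`√(ℰ(∇u) + |u(b₀)|²)`, of the Dirichlet functions vanishing near every point of `A`. -/
def R [G.LocallyFinite] (C : Sym2 V → ℝ) (b₀ : V) (A : Set Circle) : Set (V → ℝ) :=
  {f | IsHarmonic G C f ∧ IsDirichlet G C f ∧
    ∀ ε : ℝ≥0∞, 0 < ε → ∃ g : V → ℝ, IsDirichlet G C g ∧ P.VanishesNear A g ∧
      dirichletNorm G C b₀ (f - g) < ε}

/-- The space `S_A = ∇ R_A`. -/
def S [G.LocallyFinite] (C : Sym2 V → ℝ) (b₀ : V) (A : Set Circle) : Set (G.Dart → ℝ) :=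
  gradient G C '' P.R C b₀ A

/-- The paths `γ` with `d_m(γ(n), z) → 0` for some `z ∈ A`. -/
def pathsTo (A : Set Circle) : Set (InfinitePath G) :=
  {γ | ∃ z ∈ A, Filter.Tendsto (fun n => P.distBoundary (γ.vertex n) z) Filter.atTop (𝓝 0)}

end HyperbolicCirclePacking

end CirclePackedNetwork

end

namespace CirclePackedNetwork

open Filter Set

universe u

variable {V : Type u} {G : SimpleGraph V} {C : Sym2 V → ℝ}

/-! The function is found among the harmonic parts of explicit Dirichlet functions. Composing a
Lipschitz function with the disc centres gives a Dirichlet function: the squared radii have sum at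
most `1` by area, and degrees and conductances are bounded. Take for `Φ i k` the real and imaginary
parts of the centre, truncated so as to vanish near `A` (`truncNear`). Transience off `W` gives a
vertex of positive capacity (`IsTransient.exists_capacity`), so point evaluations are bounded by the
energy on finitely supported functions, and `Φ i k` splits as a harmonic `h i k` plus a limit of
finitely supported functions (`exists_harmonic_part`). Finitely supported functions vanish near `A`,
so `h i k` is a limit of functions vanishing near `A`. It remains to find a nonconstant `h i k`.

Suppose that every `h i k` is a constant `c i k`. Then `Φ i k - c i k` is a limit of finitely
supported functions. By `exists_common_metric` a single square summable metric `Q ≥ m` forces `Φ i k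
→ c i k` along every ray of finite `Q`-length tending to the circle. If such a ray ends at `ζ ∉ A`,
its coordinates are eventually the values `c i k`, so these constants leave at most one endpoint
`z₀` off `A`. Single boundary points have capacity zero (`exists_small_eq_one_near`), so `Q` can
also be chosen to exclude rays of finite length ending at `z₀`. But positive capacity in `G \ W`
yields a ray of finite `Q`-length avoiding `W` (`exists_ray_of_capacity`), and its endpoint is not
in `A` because `W` is a neighbourhood of `A` (`exists_ray_off`): a contradiction.

The statement on almost every path uses the same device: a common metric dominates differences `f -
g`, with `g` vanishing near `A`, and all exceptional paths have infinite length in it. -/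

/-! ### Energies as sums over directed edges, and area bounds. -/

/-- The variation `|g(u) - g(v)|` of a function along the edge `uv`. -/
def edgeVar (g : V → ℝ) : Sym2 V → ℝ :=
  Sym2.lift ⟨fun u v => |g u - g v|, fun u v => abs_sub_comm (g u) (g v)⟩

@[simp] lemma edgeVar_mk (g : V → ℝ) (u v : V) : edgeVar g s(u, v) = |g u - g v| := rfl

/-- The sum of `C(e) q(e)²` over the directed edges. -/
noncomputable def sqSum (G : SimpleGraph V) (C : Sym2 V → ℝ) (q : Sym2 V → ℝ) : ℝ≥0∞ :=
  ∑' d : G.Dart, ENNReal.ofReal (C d.edge * q d.edge ^ 2)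

lemma sqSum_edgeVar (g : V → ℝ) : sqSum G C (edgeVar g) =
    ∑' d : G.Dart, ENNReal.ofReal (C d.edge * (g d.snd - g d.fst) ^ 2) := by
  refine tsum_congr fun d => ?_
  have : edgeVar g d.edge = |g d.fst - g d.snd| := rfl
  rw [this, sq_abs]
  congr 2
  ring

lemma energy_gradient (hC : ∀ e ∈ G.edgeSet, 0 < C e) (g : V → ℝ) :
    energy G C (gradient G C g) = 1 / 2 * sqSum G C (edgeVar g) := by
  rw [energy, sqSum_edgeVar]
  congr 1
  refine tsum_congr fun d => ?_
  have := hC d.edge d.edge_mem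
  congr 1
  rw [gradient]
  field_simp

lemma isDirichlet_iff (hC : ∀ e ∈ G.edgeSet, 0 < C e) (g : V → ℝ) :
    IsDirichlet G C g ↔ sqSum G C (edgeVar g) < ⊤ := by
  rw [IsDirichlet, energy_gradient hC]
  constructor
  · intro h
    by_contra h'
    rw [not_lt, top_le_iff] at h'
    rw [h', ENNReal.mul_top (by simp)] at h
    exact lt_irrefl _ h
  · exact fun h => ENNReal.mul_lt_top (by simp) h

lemma metricNormSq_le_sqSum (q : Sym2 V → ℝ) : metricNormSq G C q ≤ sqSum G C q := by
  refine ENNReal.tsum_le_tsum_comp_of_surjective (f := fun d : G.Dart => (⟨d.edge, d.edge_mem⟩ : G.edgeSet))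
    ?_ (fun e : G.edgeSet => ENNReal.ofReal (C e * q e ^ 2))
  rintro ⟨e, he⟩
  induction e using Sym2.ind with
  | _ u v => exact ⟨⟨(u, v), he⟩, rfl⟩

lemma sqSum_mono (hC : ∀ e ∈ G.edgeSet, 0 < C e) {q q' : Sym2 V → ℝ}
    (h : ∀ e ∈ G.edgeSet, |q e| ≤ |q' e|) : sqSum G C q ≤ sqSum G C q' :=
  ENNReal.tsum_le_tsum fun d => ENNReal.ofReal_le_ofReal
    (mul_le_mul_of_nonneg_left (sq_le_sq.2 (h _ d.edge_mem)) (hC _ d.edge_mem).le)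

lemma sqSum_const_mul (a : ℝ) (q : Sym2 V → ℝ) :
    sqSum G C (fun e => a * q e) = ENNReal.ofReal (a ^ 2) * sqSum G C q := by
  rw [sqSum, sqSum, ← ENNReal.tsum_mul_left]
  refine tsum_congr fun d => ?_
  rw [← ENNReal.ofReal_mul (sq_nonneg a)]
  congr 1
  ring

/-- Darts correspond to pairs of a vertex and one of its neighbours. -/
def dartEquivSigma (G : SimpleGraph V) : G.Dart ≃ Σ v, G.neighborSet v where
  toFun d := ⟨d.fst, d.snd, d.adj⟩
  invFun s := ⟨(s.fst, s.snd), s.snd.property⟩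

lemma tsum_dart_fst_le [G.LocallyFinite] {D : ℕ} (hD : ∀ v, G.degree v ≤ D) (F : V → ℝ≥0∞) :
    ∑' d : G.Dart, F d.fst ≤ D * ∑' v, F v := by
  rw [← (dartEquivSigma G).symm.tsum_eq, ENNReal.tsum_sigma', ← ENNReal.tsum_mul_left]
  refine ENNReal.tsum_le_tsum fun v => ?_
  change ∑' _ : G.neighborSet v, F v ≤ _
  rw [tsum_fintype, Finset.sum_const, nsmul_eq_mul]
  gcongr
  rw [Finset.card_univ, G.card_neighborSet_eq_degree]
  exact hD v

lemma tsum_dart_snd_le [G.LocallyFinite] {D : ℕ} (hD : ∀ v, G.degree v ≤ D) (F : V → ℝ≥0∞) :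
    ∑' d : G.Dart, F d.snd ≤ D * ∑' v, F v := by
  rw [← (Function.Involutive.toPerm _ (SimpleGraph.Dart.symm_involutive (G := G))).tsum_eq]
  exact tsum_dart_fst_le hD F

/-- By `(a + b)² ≤ 2a² + 2b²`, and each vertex is the tail of at most `D` darts and the head of at
most `D`. This turns bounds on total area into bounds on energy. -/
lemma tsum_dart_add_sq_le [G.LocallyFinite] {D : ℕ} (hD : ∀ v, G.degree v ≤ D) {C₀ : ℝ}
    (hC : ∀ e ∈ G.edgeSet, C e ≤ C₀) (hC₀ : 0 ≤ C₀) (t : V → ℝ) :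
    ∑' d : G.Dart, ENNReal.ofReal (C d.edge * (t d.fst + t d.snd) ^ 2) ≤
      ENNReal.ofReal (4 * C₀ * D) * ∑' v, ENNReal.ofReal (t v ^ 2) := by
  calc ∑' d : G.Dart, ENNReal.ofReal (C d.edge * (t d.fst + t d.snd) ^ 2)
      ≤ ∑' d : G.Dart, ENNReal.ofReal (2 * C₀) *
          (ENNReal.ofReal (t d.fst ^ 2) + ENNReal.ofReal (t d.snd ^ 2)) := by
        refine ENNReal.tsum_le_tsum fun d => ?_
        rw [← ENNReal.ofReal_add (sq_nonneg _) (sq_nonneg _), ← ENNReal.ofReal_mul (by positivity)]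
        refine ENNReal.ofReal_le_ofReal ?_
        have h1 := mul_le_mul_of_nonneg_right (hC _ d.edge_mem) (sq_nonneg (t d.fst + t d.snd))
        have h2 := mul_nonneg hC₀ (sq_nonneg (t d.fst - t d.snd))
        nlinarith
    _ ≤ ENNReal.ofReal (2 * C₀) * (D * ∑' v, ENNReal.ofReal (t v ^ 2) +
          D * ∑' v, ENNReal.ofReal (t v ^ 2)) := by
        rw [ENNReal.tsum_mul_left, ENNReal.tsum_add]
        gcongr
        · exact tsum_dart_fst_le hD fun v => ENNReal.ofReal (t v ^ 2)
        · exact tsum_dart_snd_le hD fun v => ENNReal.ofReal (t v ^ 2)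
    _ = _ := by
        rw [← two_mul, ← mul_assoc, ← mul_assoc]
        congr 1
        rw [← ENNReal.ofReal_natCast, ← ENNReal.ofReal_ofNat,
          ← ENNReal.ofReal_mul (by positivity), ← ENNReal.ofReal_mul (by positivity)]
        congr 1
        ring

/-- The total squared radius of disjoint discs inside a disc. -/
lemma tsum_sq_radius_le {ι : Type*} (c : ι → ℂ) (ρ : ι → ℝ) (hρ : ∀ i, 0 ≤ ρ i)
    (hd : ∀ i j, i ≠ j → Disjoint (Metric.ball (c i) (ρ i)) (Metric.ball (c j) (ρ j)))
    (z : ℂ) {R : ℝ} (hR : 0 ≤ R) (hs : ∀ i, Metric.ball (c i) (ρ i) ⊆ Metric.closedBall z R) :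
    ∑' i, ENNReal.ofReal (ρ i ^ 2) ≤ ENNReal.ofReal (R ^ 2) := by
  rw [ENNReal.tsum_eq_iSup_sum]
  refine iSup_le fun s => ?_
  have h1 : MeasureTheory.volume (⋃ i ∈ s, Metric.ball (c i) (ρ i)) ≤
      MeasureTheory.volume (Metric.closedBall z R) :=
    MeasureTheory.measure_mono (Set.iUnion₂_subset fun i _ => hs i)
  rw [MeasureTheory.measure_biUnion_finset (fun i _ j _ hij => hd i j hij)
    (fun i _ => Metric.isOpen_ball.measurableSet)] at h1
  simp only [Complex.volume_ball, Complex.volume_closedBall] at h1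
  rw [← Finset.sum_mul] at h1
  have hpi : (NNReal.pi : ℝ≥0∞) ≠ 0 := by
    simpa using NNReal.pi_ne_zero
  rw [ENNReal.mul_le_mul_iff_left hpi ENNReal.coe_ne_top] at h1
  simpa only [ENNReal.ofReal_pow (hρ _), ENNReal.ofReal_pow hR] using h1

/-! ### Variation along paths -/

lemma dist_le_sum_edges {X : Type*} [PseudoMetricSpace X] {F : V → X} {q : Sym2 V → ℝ}
    (h : ∀ u v, G.Adj u v → dist (F u) (F v) ≤ q s(u, v)) {u v : V} (p : G.Walk u v) :
    dist (F u) (F v) ≤ (p.edges.map q).sum := by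
  induction p with
  | nil => simp
  | cons hadj p ih =>
    simp only [SimpleGraph.Walk.edges_cons, List.map_cons, List.sum_cons]
    exact (dist_triangle _ _ _).trans (add_le_add (h _ _ hadj) ih)

lemma InfinitePath.exists_walk (γ : InfinitePath G) (n : ℕ) :
    ∃ p : G.Walk (γ.vertex 0) (γ.vertex n), ∀ e ∈ p.edges, e ∈ γ.edges := by
  induction n with
  | zero => exact ⟨.nil, by simp⟩
  | succ n ih =>
    obtain ⟨p, hp⟩ := ih
    refine ⟨p.concat (γ.adj n), fun e he => ?_⟩
    rw [SimpleGraph.Walk.edges_concat, List.concat_eq_append, List.mem_append] at he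
    rcases he with he | he
    · exact hp e he
    · rw [List.mem_singleton] at he
      exact ⟨n, he.symm⟩

/-- A path may repeat edges while its length counts each one once, so the initial segment is first
replaced by its loop-erased `bypass`, which uses each edge at most once. -/
lemma edist_le_pathLength {X : Type*} [PseudoMetricSpace X] {F : V → X} {q : Sym2 V → ℝ}
    (h : ∀ u v, G.Adj u v → dist (F u) (F v) ≤ q s(u, v)) (γ : InfinitePath G) (n : ℕ) :
    edist (F (γ.vertex 0)) (F (γ.vertex n)) ≤ pathLength q γ := by
  classical
  obtain ⟨p, hp⟩ := γ.exists_walk n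
  have hnd : p.bypass.edges.Nodup := p.bypass_isPath.isTrail.edges_nodup
  have hsub : ∀ e ∈ p.bypass.edges, e ∈ γ.edges := fun e he => hp e (p.edges_bypass_subset_edges he)
  have hq : ∀ e ∈ p.bypass.edges, 0 ≤ q e := by
    intro e he
    have := p.bypass.edges_subset_edgeSet he
    induction e using Sym2.ind with
    | _ u v => exact dist_nonneg.trans (h u v this)
  have h1 := dist_le_sum_edges h p.bypass
  rw [edist_dist]
  calc ENNReal.ofReal (dist (F (γ.vertex 0)) (F (γ.vertex n)))
      ≤ ENNReal.ofReal (∑ e ∈ p.bypass.edges.toFinset, q e) := by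
        rw [List.sum_toFinset _ hnd]
        exact ENNReal.ofReal_le_ofReal h1
    _ = ∑ e ∈ p.bypass.edges.toFinset, ENNReal.ofReal (q e) :=
        ENNReal.ofReal_sum_of_nonneg fun e he => hq e (List.mem_toFinset.1 he)
    _ = ∑ e ∈ p.bypass.edges.toFinset.subtype (· ∈ γ.edges), ENNReal.ofReal (q e) := by
        rw [Finset.sum_subtype_of_mem (fun e => ENNReal.ofReal (q e))]
        exact fun e he => hsub e (List.mem_toFinset.1 he)
    _ ≤ pathLength q γ := ENNReal.sum_le_tsum _

lemma pathLength_le_tsum (q : Sym2 V → ℝ) (γ : InfinitePath G) :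
    pathLength q γ ≤ ∑' n, ENNReal.ofReal (q s(γ.vertex n, γ.vertex (n + 1))) :=
  ENNReal.tsum_le_tsum_comp_of_surjective Set.rangeFactorization_surjective
    (fun e : γ.edges => ENNReal.ofReal (q e))

lemma pathLength_const_mul {a : ℝ} (ha : 0 ≤ a) (q : Sym2 V → ℝ) (γ : InfinitePath G) :
    pathLength (fun e => a * q e) γ = ENNReal.ofReal a * pathLength q γ := by
  rw [pathLength, pathLength, ← ENNReal.tsum_mul_left]
  exact tsum_congr fun e => ENNReal.ofReal_mul ha

lemma IsThreeConnected.reachable (h : IsThreeConnected G) (u v : V) : G.Reachable u v := by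
  obtain ⟨x, hx⟩ : ∃ x, x ∉ ({u, v} : Set V) := by
    by_contra! hx
    have h1 : (Set.univ : Set V) ⊆ {u, v} := fun x _ => hx x
    have h2 := Set.encard_le_encard h1
    rw [Set.encard_univ] at h2
    have h3 := h.1.trans (h2.trans (Set.encard_insert_le _ _))
    rw [Set.encard_singleton] at h3
    exact absurd h3 (by decide)
  simp only [Set.mem_insert_iff, Set.mem_singleton_iff, not_or] at hx
  have hc := (h.2 x x).preconnected ⟨u, by simpa using Ne.symm hx.1⟩ ⟨v, by simpa using Ne.symm hx.2⟩
  exact hc.map (SimpleGraph.Embedding.induce _).toHom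

/-! ### Boundary distance and functions vanishing near the boundary set. -/

namespace HyperbolicCirclePacking

variable (P : HyperbolicCirclePacking G)

@[simp] lemma m_mk (u v : V) : P.m s(u, v) = P.radius u + P.radius v := rfl

lemma m_pos (e : Sym2 V) : 0 < P.m e := by
  induction e using Sym2.ind with
  | _ u v => exact add_pos (P.radius_pos u) (P.radius_pos v)

lemma dist_center {u v : V} (h : G.Adj u v) : dist (P.center u) (P.center v) = P.m s(u, v) :=
  (P.nerve u v h.ne).1 h

lemma tsum_radius_sq_le : ∑' v, ENNReal.ofReal (P.radius v ^ 2) ≤ 1 := by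
  have := tsum_sq_radius_le P.center P.radius (fun v => (P.radius_pos v).le) P.disjoint_interiors 0
    zero_le_one fun v => (Metric.ball_subset_closedBall.trans (P.subset_disc v)).trans
      Metric.ball_subset_closedBall
  simpa using this

lemma sqSum_m_lt_top [G.LocallyFinite] {D : ℕ} (hD : ∀ v, G.degree v ≤ D) {C₀ : ℝ}
    (hC : ∀ e ∈ G.edgeSet, C e ≤ C₀) (hC₀ : 0 ≤ C₀) : sqSum G C P.m < ⊤ :=
  (tsum_dart_add_sq_le hD hC hC₀ P.radius).trans_lt
    (ENNReal.mul_lt_top ENNReal.ofReal_lt_top (P.tsum_radius_sq_le.trans_lt ENNReal.one_lt_top))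

lemma norm_center_lt (v : V) : ‖P.center v‖ < 1 := by
  simpa using P.subset_disc v (Metric.mem_closedBall_self (P.radius_pos v).le)

/-- A disc of the packing does not contain points of the unit circle. -/
lemma radius_lt_dist (v : V) (z : Circle) : P.radius v < dist (P.center v) z := by
  by_contra! h
  have := P.subset_disc v (show (z : ℂ) ∈ _ by rwa [Metric.mem_closedBall, dist_comm])
  simp [Circle.norm_coe] at this

/-- The first edge of any path from `v` already has this length. Hence a finite set of vertices
stays away from each boundary point. -/
lemma ofReal_radius_le_distBoundary (v : V) (z : Circle) :
    ENNReal.ofReal (P.radius v) ≤ P.distBoundary v z := by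
  refine le_iInf fun γ => le_iInf fun h0 => le_iInf fun _ => ?_
  subst h0
  have : s(γ.vertex 0, γ.vertex 1) ∈ γ.edges := ⟨0, rfl⟩
  refine le_trans ?_ (ENNReal.le_tsum (⟨_, this⟩ : γ.edges))
  exact ENNReal.ofReal_le_ofReal (le_add_of_nonneg_right (P.radius_pos _).le)

/-- Adjacent centres are exactly `m` apart, so `m`-length dominates Euclidean displacement.
Euclidean neighbourhoods of a boundary point therefore give neighbourhoods for `m`. -/
lemma edist_le_distBoundary (v : V) (z : Circle) :
    edist (P.center v) z ≤ P.distBoundary v z := by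
  refine le_iInf fun γ => le_iInf fun h0 => le_iInf fun h => ?_
  subst h0
  refine le_of_tendsto (tendsto_const_nhds.edist h) (Eventually.of_forall fun n => ?_)
  exact edist_le_pathLength (fun u v h => (P.dist_center h).le) γ n

lemma distBoundary_le (γ : InfinitePath G) (z : Circle)
    (h : Tendsto (fun n => P.center (γ.vertex n)) atTop (𝓝 (z : ℂ))) :
    P.distBoundary (γ.vertex 0) z ≤ pathLength P.m γ :=
  iInf_le_of_le γ (iInf_le_of_le rfl (iInf_le_of_le h le_rfl))

lemma sqSum_edgeVar_lipschitz_lt_top [G.LocallyFinite] {D : ℕ} (hD : ∀ v, G.degree v ≤ D) {C₀ : ℝ}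
    (hCpos : ∀ e ∈ G.edgeSet, 0 < C e) (hC : ∀ e ∈ G.edgeSet, C e ≤ C₀) (hC₀ : 0 ≤ C₀)
    {φ : ℂ → ℝ} {L : NNReal} (hφ : LipschitzWith L φ) :
    sqSum G C (edgeVar fun v => φ (P.center v)) < ⊤ := by
  refine lt_of_le_of_lt (sqSum_mono hCpos (q' := fun e => L * P.m e) fun e he => ?_) ?_
  · induction e using Sym2.ind with
    | _ u v =>
      rw [edgeVar_mk, abs_abs, abs_of_nonneg (mul_nonneg L.coe_nonneg (P.m_pos _).le), ← P.dist_center he]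
      exact hφ.dist_le_mul _ _
  · rw [sqSum_const_mul]
    exact ENNReal.mul_lt_top ENNReal.ofReal_lt_top (P.sqSum_m_lt_top hD hC hC₀)

lemma IsNbhd.inter {z : Circle} {W W' : Set V} (h : P.IsNbhd z W) (h' : P.IsNbhd z W') :
    P.IsNbhd z (W ∩ W') := by
  obtain ⟨r, hr, h⟩ := h
  obtain ⟨r', hr', h'⟩ := h'
  exact ⟨min r r', lt_min hr hr', fun v hv => ⟨h v (hv.trans_le (min_le_left _ _)),
    h' v (hv.trans_le (min_le_right _ _))⟩⟩

lemma VanishesNear.sub {A : Set Circle} {f g : V → ℝ} (hf : P.VanishesNear A f)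
    (hg : P.VanishesNear A g) : P.VanishesNear A (f - g) := by
  intro z hz
  obtain ⟨W, hW, h⟩ := hf z hz
  obtain ⟨W', hW', h'⟩ := hg z hz
  refine ⟨W ∩ W', IsNbhd.inter P hW hW', ?_⟩
  ext v
  simp only [Set.mem_inter_iff, Function.mem_support, Set.mem_empty_iff_false, iff_false]
  rintro ⟨hv, hvW, hvW'⟩
  have h1 : f v = 0 := by
    by_contra h1
    exact (h ▸ (⟨h1, hvW⟩ : v ∈ Function.support f ∩ W) : v ∈ (∅ : Set V))
  have h2 : g v = 0 := by
    by_contra h2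
    exact (h' ▸ (⟨h2, hvW'⟩ : v ∈ Function.support g ∩ W') : v ∈ (∅ : Set V))
  exact hv (by simp [h1, h2])

lemma vanishesNear_of_finite_support (A : Set Circle) {f : V → ℝ} (hf : f.support.Finite) :
    P.VanishesNear A f := by
  intro z _
  obtain ⟨r, hr, h⟩ : ∃ r : ℝ≥0∞, 0 < r ∧ ∀ v ∈ f.support, r ≤ P.distBoundary v z := by
    rcases f.support.eq_empty_or_nonempty with he | hne
    · exact ⟨1, one_pos, by simp [he]⟩
    · obtain ⟨v, -, hv⟩ := Set.exists_min_image _ (fun v => P.distBoundary v z) hf hne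
      exact ⟨_, (ENNReal.ofReal_pos.2 (P.radius_pos v)).trans_le
        (P.ofReal_radius_le_distBoundary v z), hv⟩
  refine ⟨{v | P.distBoundary v z < r}, ⟨r, hr, fun v hv => hv⟩, ?_⟩
  ext v
  simp only [Set.mem_inter_iff, Set.mem_ofPred_eq, Set.mem_empty_iff_false, iff_false]
  rintro ⟨hv, hv'⟩
  exact absurd (h v hv) (not_le.2 hv')

lemma vanishesNear_comp_center {A : Set Circle} {φ : ℂ → ℝ} {r : ℝ} (hr : 0 < r)
    (hφ : ∀ x : ℂ, ∀ z ∈ A, dist x z < r → φ x = 0) : P.VanishesNear A fun v => φ (P.center v) := by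
  intro z hz
  refine ⟨{v | P.distBoundary v z < ENNReal.ofReal r}, ⟨_, ENNReal.ofReal_pos.2 hr, fun v hv => hv⟩,
    ?_⟩
  ext v
  simp only [Set.mem_inter_iff, Set.mem_ofPred_eq, Set.mem_empty_iff_false, iff_false]
  rintro ⟨hv, hv'⟩
  refine hv (hφ _ z hz ?_)
  have := (P.edist_le_distBoundary v z).trans_lt hv'
  rw [edist_dist] at this
  exact (ENNReal.ofReal_lt_ofReal_iff hr).1 this

end HyperbolicCirclePacking

/-! ### Capacity of a vertex of a transient network -/

open Classical in
/-- The conductances as a matrix, zero off the edges. -/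
noncomputable def condMatrix (G : SimpleGraph V) (C : Sym2 V → ℝ) (x y : V) : ℝ :=
  if G.Adj x y then C s(x, y) else 0

lemma condMatrix_symm (x y : V) : condMatrix G C x y = condMatrix G C y x := by
  by_cases h : G.Adj x y
  · rw [condMatrix, condMatrix, if_pos h, if_pos h.symm, Sym2.eq_swap]
  · rw [condMatrix, condMatrix, if_neg h, if_neg fun h' => h h'.symm]

lemma condMatrix_nonneg (hC : ∀ e ∈ G.edgeSet, 0 < C e) (x y : V) : 0 ≤ condMatrix G C x y := by
  rw [condMatrix]
  split_ifs with h
  · exact (hC _ h).le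
  · exact le_rfl

/-- The total conductance at a vertex. -/
noncomputable def conductanceAt (G : SimpleGraph V) [G.LocallyFinite] (C : Sym2 V → ℝ) (x : V) : ℝ :=
  ∑ y ∈ G.neighborFinset x, C s(x, y)

lemma sum_condMatrix_mul [G.LocallyFinite] {S : Finset V} {x : V}
    (hS : G.neighborFinset x ⊆ S) (g : V → ℝ) :
    ∑ y ∈ S, condMatrix G C x y * g y = ∑ y ∈ G.neighborFinset x, C s(x, y) * g y := by
  classical
  rw [← Finset.sum_subset hS]
  · refine Finset.sum_congr rfl fun y hy => ?_
    rw [condMatrix, if_pos ((G.mem_neighborFinset _ _).1 hy)]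
  · intro y _ hy
    rw [condMatrix, if_neg (by simpa using hy), zero_mul]

/-- Discrete Green formula: summation by parts, using the symmetry of `c`. The factor `2` comes from
summing over ordered pairs. -/
lemma sum_mul_gradient_eq (S : Finset V) (c : V → V → ℝ) (hc : ∀ x y, c x y = c y x) (f g : V → ℝ) :
    ∑ x ∈ S, ∑ y ∈ S, c x y * ((f y - f x) * (g y - g x)) =
      2 * ∑ x ∈ S, f x * ∑ y ∈ S, c x y * (g x - g y) := by
  have h1 : ∑ x ∈ S, ∑ y ∈ S, c x y * (f y * (g y - g x)) =
      ∑ x ∈ S, ∑ y ∈ S, c x y * (f x * (g x - g y)) := by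
    rw [Finset.sum_comm]
    exact Finset.sum_congr rfl fun x _ => Finset.sum_congr rfl fun y _ => by rw [hc]
  calc ∑ x ∈ S, ∑ y ∈ S, c x y * ((f y - f x) * (g y - g x))
      = ∑ x ∈ S, ∑ y ∈ S, c x y * (f y * (g y - g x)) +
        ∑ x ∈ S, ∑ y ∈ S, c x y * (f x * (g x - g y)) := by
        rw [← Finset.sum_add_distrib]
        refine Finset.sum_congr rfl fun x _ => ?_
        rw [← Finset.sum_add_distrib]
        exact Finset.sum_congr rfl fun y _ => by ring
    _ = 2 * ∑ x ∈ S, f x * ∑ y ∈ S, c x y * (g x - g y) := by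
        rw [h1, ← two_mul]
        congr 1
        refine Finset.sum_congr rfl fun x _ => ?_
        rw [Finset.mul_sum]
        exact Finset.sum_congr rfl fun y _ => by ring

lemma sum_mul_gradient_sq_le (S : Finset V) (c : V → V → ℝ) (hc : ∀ x y, 0 ≤ c x y) (f g : V → ℝ) :
    (∑ x ∈ S, ∑ y ∈ S, c x y * ((f y - f x) * (g y - g x))) ^ 2 ≤
      (∑ x ∈ S, ∑ y ∈ S, c x y * (f y - f x) ^ 2) *
        ∑ x ∈ S, ∑ y ∈ S, c x y * (g y - g x) ^ 2 := by
  simp only [← Finset.sum_product']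
  have h := Finset.sum_mul_sq_le_sq_mul_sq (S ×ˢ S)
    (fun p => √(c p.1 p.2) * (f p.2 - f p.1)) (fun p => √(c p.1 p.2) * (g p.2 - g p.1))
  have h0 : ∀ p : V × V, c p.1 p.2 * ((f p.2 - f p.1) * (g p.2 - g p.1)) =
      √(c p.1 p.2) * (f p.2 - f p.1) * (√(c p.1 p.2) * (g p.2 - g p.1)) := fun p => by
    rw [mul_mul_mul_comm, Real.mul_self_sqrt (hc _ _)]
  simpa only [h0, mul_pow, Real.sq_sqrt (hc _ _)] using h

lemma sum_condMatrix_le_sqSum (S : Finset V) (f : V → ℝ) (hC : ∀ e ∈ G.edgeSet, 0 < C e) :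
    ENNReal.ofReal (∑ x ∈ S, ∑ y ∈ S, condMatrix G C x y * (f y - f x) ^ 2) ≤
      sqSum G C (edgeVar f) := by
  classical
  rw [← Finset.sum_product' S S (fun x y => condMatrix G C x y * (f y - f x) ^ 2),
    ENNReal.ofReal_sum_of_nonneg
      fun p _ => mul_nonneg (condMatrix_nonneg hC _ _) (sq_nonneg _), sqSum_edgeVar]
  refine (ENNReal.sum_le_tsum _).trans (le_of_eq ?_)
  rw [← (SimpleGraph.Dart.toProd_injective (G := G)).tsum_eq]
  · refine tsum_congr fun d => ?_
    rw [condMatrix, if_pos d.adj]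
    rfl
  · intro p hp
    by_contra hr
    refine hp ?_
    have : ¬ G.Adj p.1 p.2 := fun h => hr ⟨⟨p, h⟩, rfl⟩
    simp [condMatrix, this]

section

variable [G.LocallyFinite]

lemma conductanceAt_nonneg (hC : ∀ e ∈ G.edgeSet, 0 < C e) (x : V) : 0 ≤ conductanceAt G C x :=
  Finset.sum_nonneg fun y hy => (hC _ (by simpa using hy)).le

lemma conductanceAt_pos (hC : ∀ e ∈ G.edgeSet, 0 < C e) {x y : V} (h : G.Adj x y) :
    0 < conductanceAt G C x :=
  Finset.sum_pos (fun y hy => hC _ (by simpa using hy)) ⟨y, by simpa using h⟩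

lemma transitionProb_of_adj (hC : ∀ e ∈ G.edgeSet, 0 < C e) {x y : V} (h : G.Adj x y) :
    transitionProb G C x y = ENNReal.ofReal (C s(x, y) / conductanceAt G C x) := by
  rw [transitionProb, if_pos h, ENNReal.ofReal_div_of_pos (conductanceAt_pos hC h)]
  congr 1
  rw [conductanceAt, ENNReal.ofReal_sum_of_nonneg fun y hy => (hC _ (by simpa using hy)).le,
    tsum_fintype, SimpleGraph.neighborFinset, ← Finset.sum_set_coe]

lemma stepProb_succ (n : ℕ) (x a : V) : stepProb G C (n + 1) x a =
    ∑ z ∈ G.neighborFinset x, transitionProb G C x z * stepProb G C n z a := by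
  rw [stepProb, tsum_eq_sum]
  intro z hz
  rw [transitionProb, if_neg (by simpa using hz), zero_mul]

lemma stepProb_ne_top (hC : ∀ e ∈ G.edgeSet, 0 < C e) (n : ℕ) (x a : V) :
    stepProb G C n x a ≠ ⊤ := by
  induction n generalizing x with
  | zero =>
    rw [stepProb]
    split_ifs <;> simp
  | succ n ih =>
    rw [stepProb_succ]
    refine ENNReal.sum_ne_top.2 fun z hz => ENNReal.mul_ne_top ?_ (ih z)
    rw [transitionProb_of_adj hC (by simpa using hz)]
    exact ENNReal.ofReal_ne_top

lemma conductanceAt_mul_stepProb (hC : ∀ e ∈ G.edgeSet, 0 < C e) (n : ℕ) (x a : V) :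
    conductanceAt G C x * (stepProb G C (n + 1) x a).toReal =
      ∑ z ∈ G.neighborFinset x, C s(x, z) * (stepProb G C n z a).toReal := by
  rw [stepProb_succ, ENNReal.toReal_sum, Finset.mul_sum]
  · refine Finset.sum_congr rfl fun z hz => ?_
    have h : G.Adj x z := by simpa using hz
    have h1 := conductanceAt_pos hC h
    rw [transitionProb_of_adj hC h, ENNReal.toReal_mul,
      ENNReal.toReal_ofReal (div_nonneg (hC _ h).le h1.le)]
    field_simp
  · intro z hz
    refine ENNReal.mul_ne_top ?_ (stepProb_ne_top hC n z a)
    rw [transitionProb_of_adj hC (by simpa using hz)]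
    exact ENNReal.ofReal_ne_top

lemma finite_support_stepProb (n : ℕ) (a : V) :
    {x | stepProb G C n x a ≠ 0}.Finite := by
  classical
  induction n with
  | zero =>
    refine (Set.finite_singleton a).subset fun x hx => ?_
    by_contra h
    exact hx (if_neg h)
  | succ n ih =>
    refine (ih.biUnion fun z _ => (G.neighborFinset z).finite_toSet).subset fun x hx => ?_
    rw [Set.mem_ofPred_eq, stepProb_succ] at hx
    obtain ⟨z, hz, h⟩ := Finset.exists_ne_zero_of_sum_ne_zero hx
    refine Set.mem_biUnion (x := z) (right_ne_zero_of_mul h) ?_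
    simpa [G.adj_comm] using hz

/-- At `a` itself the terms of a convergent series tend to zero. This passes to a neighbour `u` of
`v` because one step from `v` may lead to `u`: `C(vu) pₙ(u,a) ≤ π(v) pₙ₊₁(v,a)`, where `π` is the
total conductance. -/
lemma tendsto_stepProb_of_walk (hC : ∀ e ∈ G.edgeSet, 0 < C e) {a y : V}
    (ha : ∑' n, stepProb G C n a a < ⊤) (p : G.Walk y a) :
    Tendsto (fun n => (stepProb G C n y a).toReal) atTop (𝓝 0) := by
  induction p with
  | nil =>
    have := ENNReal.tendsto_atTop_zero_of_tsum_ne_top ha.ne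
    exact (ENNReal.tendsto_toReal ENNReal.zero_ne_top).comp this
  | @cons u v a h q ih =>
    have hpos := hC _ ((G.mem_edgeSet).2 h.symm)
    have h1 : Tendsto (fun n => conductanceAt G C v * (stepProb G C (n + 1) v a).toReal / C s(v, u))
        atTop (𝓝 0) := by
      simpa using ((((ih ha).comp (tendsto_add_atTop_nat 1)).const_mul
        (conductanceAt G C v)).div_const (C s(v, u)))
    refine squeeze_zero (fun n => ENNReal.toReal_nonneg) (fun n => ?_) h1
    rw [le_div_iff₀ hpos, conductanceAt_mul_stepProb hC, mul_comm]
    exact Finset.single_le_sum (f := fun z => C s(v, z) * (stepProb G C n z a).toReal)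
      (fun z hz => mul_nonneg (hC _ (by simpa using hz)).le ENNReal.toReal_nonneg)
      (by simpa using h.symm)

lemma stepProb_eq_zero_of_not_reachable {a y : V} (h : ¬ G.Reachable y a) (n : ℕ) :
    stepProb G C n y a = 0 := by
  induction n generalizing y with
  | zero =>
    rw [stepProb, if_neg]
    rintro rfl
    exact h (SimpleGraph.Reachable.refl _)
  | succ n ih =>
    rw [stepProb_succ]
    refine Finset.sum_eq_zero fun z hz => ?_
    have hz' : G.Adj y z := by simpa using hz
    rw [ih fun h' => h (hz'.reachable.trans h'), mul_zero]

lemma tendsto_stepProb (hC : ∀ e ∈ G.edgeSet, 0 < C e) {a : V}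
    (ha : ∑' n, stepProb G C n a a < ⊤) (y : V) :
    Tendsto (fun n => (stepProb G C n y a).toReal) atTop (𝓝 0) := by
  by_cases h : G.Reachable y a
  · exact tendsto_stepProb_of_walk hC ha h.some
  · simp [stepProb_eq_zero_of_not_reachable h]

/-- The Green function of the walk killed after `n` steps. -/
noncomputable def truncGreen (G : SimpleGraph V) (C : Sym2 V → ℝ) (a : V) (n : ℕ) (x : V) : ℝ :=
  ∑ k ∈ Finset.range (n + 1), (stepProb G C k x a).toReal

/-- One step of the walk shifts the index of each `pₖ`, so the sum telescopes and only the first and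
last terms survive. -/
lemma laplacian_truncGreen (hC : ∀ e ∈ G.edgeSet, 0 < C e) (a : V) (n : ℕ) (x : V) :
    ∑ y ∈ G.neighborFinset x, C s(x, y) * (truncGreen G C a n x - truncGreen G C a n y) =
      conductanceAt G C x *
        ((stepProb G C 0 x a).toReal - (stepProb G C (n + 1) x a).toReal) := by
  have h1 : ∑ y ∈ G.neighborFinset x, C s(x, y) * truncGreen G C a n y =
      conductanceAt G C x * ∑ k ∈ Finset.range (n + 1), (stepProb G C (k + 1) x a).toReal := by
    simp only [truncGreen, Finset.mul_sum, conductanceAt_mul_stepProb hC]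
    exact Finset.sum_comm
  have h2 := Finset.sum_range_succ' (fun k => (stepProb G C k x a).toReal) (n + 1)
  rw [Finset.sum_range_succ] at h2
  simp only [mul_sub, Finset.sum_sub_distrib, h1, ← Finset.sum_mul]
  change conductanceAt G C x * truncGreen G C a n x - _ = _
  rw [← mul_sub, ← mul_sub]
  congr 1
  rw [truncGreen]
  linarith

/-- Green's formula bound for finitely supported functions. -/
lemma sq_sub_sum_le (hC : ∀ e ∈ G.edgeSet, 0 < C e) {a : V} {Γ : ℝ} (n : ℕ)
    (hΓ : truncGreen G C a n a ≤ Γ) (f : V → ℝ)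
    (S₀ : Finset V) (hf : ∀ x, f x ≠ 0 → x ∈ S₀) (haS : a ∈ S₀) {E : ℝ}
    (hE : ∀ S : Finset V, ∑ x ∈ S, ∑ y ∈ S, condMatrix G C x y * (f y - f x) ^ 2 ≤ E) :
    (f a * conductanceAt G C a -
      ∑ x ∈ S₀, f x * (conductanceAt G C x * (stepProb G C (n + 1) x a).toReal)) ^ 2 ≤
      E * (conductanceAt G C a * Γ) := by
  classical
  set g := truncGreen G C a n with hg
  set π := conductanceAt G C with hπ
  have hg0 : ∀ x, 0 ≤ g x := fun x => Finset.sum_nonneg fun k _ => ENNReal.toReal_nonneg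
  obtain ⟨S₁, hS₁⟩ : ∃ S₁ : Finset V, ∀ x, g x ≠ 0 → x ∈ S₁ := by
    refine ⟨(Finset.range (n + 1)).biUnion fun k => (finite_support_stepProb (G := G) (C := C) k a).toFinset,
      fun x hx => ?_⟩
    obtain ⟨k, hk, hk'⟩ := Finset.exists_ne_zero_of_sum_ne_zero hx
    refine Finset.mem_biUnion.2 ⟨k, hk, ?_⟩
    simp only [Set.Finite.mem_toFinset, Set.mem_ofPred_eq]
    exact fun h => hk' (by simp [h])
  set T := S₀ ∪ S₁ with hT
  -- Adding the neighbours of `T` makes sums over `S` compute the full Laplacian at every point of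
  -- `T`.
  set S := T ∪ T.biUnion fun x => G.neighborFinset x with hS
  have hnb : ∀ x ∈ T, G.neighborFinset x ⊆ S := fun x hx =>
    (Finset.subset_biUnion_of_mem (fun x => G.neighborFinset x) hx).trans Finset.subset_union_right
  have hTS : T ⊆ S := Finset.subset_union_left
  have hdelta : ∀ x, (stepProb G C 0 x a).toReal = if x = a then 1 else 0 := by
    intro x
    rw [stepProb]
    split_ifs <;> simp
  have key : ∀ φ : V → ℝ, (∀ x, φ x ≠ 0 → x ∈ T) →
      ∑ x ∈ S, φ x * ∑ y ∈ S, condMatrix G C x y * (g x - g y) =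
        φ a * π a - ∑ x ∈ T, φ x * (π x * (stepProb G C (n + 1) x a).toReal) := by
    intro φ hφ
    rw [← Finset.sum_subset hTS fun x _ hx => by
      rw [by_contra fun h => hx (hφ x h), zero_mul]]
    have : ∀ x ∈ T, φ x * ∑ y ∈ S, condMatrix G C x y * (g x - g y) =
        (if x = a then φ a * π a else 0) - φ x * (π x * (stepProb G C (n + 1) x a).toReal) := by
      intro x hx
      rw [sum_condMatrix_mul (hnb x hx) (fun y => g x - g y), hg, laplacian_truncGreen hC, hdelta]
      split_ifs with h
      · subst h; ring
      · ring
    rw [Finset.sum_congr rfl this, Finset.sum_sub_distrib, Finset.sum_ite_eq' T a,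
      if_pos (Finset.mem_union_left _ haS)]
  have hcm := condMatrix_nonneg (G := G) hC
  have hfB := key f fun x hx => Finset.mem_union_left _ (hf x hx)
  have hgB := key g fun x hx => Finset.mem_union_right _ (hS₁ x hx)
  have hfT : ∑ x ∈ T, f x * (π x * (stepProb G C (n + 1) x a).toReal) =
      ∑ x ∈ S₀, f x * (π x * (stepProb G C (n + 1) x a).toReal) :=
    (Finset.sum_subset Finset.subset_union_left fun x _ hx => by
      rw [by_contra fun h => hx (hf x h), zero_mul]).symm
  have hπ0 : ∀ x, 0 ≤ π x := conductanceAt_nonneg hC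
  have hgB' : ∑ x ∈ S, g x * ∑ y ∈ S, condMatrix G C x y * (g x - g y) ≤ π a * Γ := by
    rw [hgB]
    have h0 : 0 ≤ ∑ x ∈ T, g x * (π x * (stepProb G C (n + 1) x a).toReal) :=
      Finset.sum_nonneg fun x _ => mul_nonneg (hg0 x) (mul_nonneg (hπ0 x) ENNReal.toReal_nonneg)
    nlinarith [mul_le_mul_of_nonneg_left hΓ (hπ0 a)]
  have hCS := sum_mul_gradient_sq_le S (condMatrix G C) hcm f g
  have hgg := sum_mul_gradient_eq S (condMatrix G C) condMatrix_symm g g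
  have hE0 : 0 ≤ ∑ x ∈ S, ∑ y ∈ S, condMatrix G C x y * (f y - f x) ^ 2 :=
    Finset.sum_nonneg fun x _ => Finset.sum_nonneg fun y _ => mul_nonneg (hcm x y) (sq_nonneg _)
  have hG0 : 0 ≤ ∑ x ∈ S, ∑ y ∈ S, condMatrix G C x y * (g y - g x) ^ 2 :=
    Finset.sum_nonneg fun x _ => Finset.sum_nonneg fun y _ => mul_nonneg (hcm x y) (sq_nonneg _)
  simp only [← sq] at hgg
  rw [sum_mul_gradient_eq S (condMatrix G C) condMatrix_symm f g, hfB, hfT] at hCS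
  have h3 := mul_le_mul (hE S) (hgg.le.trans (mul_le_mul_of_nonneg_left hgB' zero_le_two)) hG0
    (hE0.trans (hE S))
  -- Cauchy–Schwarz gives `(2X)² ≤ E · 2π(a)Γ`, hence half the claimed bound; nonnegativity allows
  -- the spare factor to be dropped.
  have h4 : 0 ≤ E * (π a * Γ) := by
    have := mul_nonneg (hE0.trans (hE S)) (hG0.trans (hgg.le.trans
      (mul_le_mul_of_nonneg_left hgB' zero_le_two)))
    linarith
  nlinarith

/-- A transient network has a vertex of positive capacity. -/
theorem IsTransient.exists_capacity (hC : ∀ e ∈ G.edgeSet, 0 < C e) (h : IsTransient G C) :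
    ∃ a : V, ∃ K : ℝ≥0∞, K < ⊤ ∧ ∀ f : V → ℝ, f.support.Finite →
      ENNReal.ofReal (f a ^ 2) ≤ K * sqSum G C (edgeVar f) := by
  classical
  obtain ⟨a, ⟨b, hab⟩, ha⟩ := h
  set Γ := (∑' n, stepProb G C n a a).toReal with hΓ
  have hπ := conductanceAt_pos hC hab
  have hΓn : ∀ n, truncGreen G C a n a ≤ Γ := by
    intro n
    rw [truncGreen, ← ENNReal.toReal_sum fun k _ => stepProb_ne_top hC k a a]
    exact ENNReal.toReal_mono ha.ne (ENNReal.sum_le_tsum _)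
  -- The visit at time `0` contributes `1`. Positivity of `Γ` makes the capacity constant nonzero,
  -- as the case of infinite energy needs.
  have hΓ1 : 1 ≤ Γ := by
    refine le_trans ?_ (hΓn 0)
    simp [truncGreen, stepProb]
  refine ⟨a, ENNReal.ofReal (Γ / conductanceAt G C a), ENNReal.ofReal_lt_top, fun f hf => ?_⟩
  by_cases hE : sqSum G C (edgeVar f) = ⊤
  · rw [hE, ENNReal.mul_top]
    · exact le_top
    · exact (ENNReal.ofReal_pos.2 (by positivity)).ne'
  set E := (sqSum G C (edgeVar f)).toReal with hEdef
  have hES : ∀ S : Finset V, ∑ x ∈ S, ∑ y ∈ S, condMatrix G C x y * (f y - f x) ^ 2 ≤ E := fun S =>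
    (ENNReal.ofReal_le_iff_le_toReal hE).1 (sum_condMatrix_le_sqSum S f hC)
  set S₀ := insert a hf.toFinset
  -- The error term is a sum over a fixed finite set, and each `pₙ₊₁(x,a)` tends to zero.
  have hlim : Tendsto (fun n => (f a * conductanceAt G C a -
      ∑ x ∈ S₀, f x * (conductanceAt G C x * (stepProb G C (n + 1) x a).toReal)) ^ 2) atTop
      (𝓝 ((f a * conductanceAt G C a - ∑ x ∈ S₀, f x * (conductanceAt G C x * 0)) ^ 2)) := by
    refine ((tendsto_finsetSum _ fun x _ => ?_).const_sub _).pow 2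
    exact (((tendsto_stepProb hC ha x).comp (tendsto_add_atTop_nat 1)).const_mul _).const_mul _
  have h1 := le_of_tendsto' hlim fun n => sq_sub_sum_le hC n (hΓn n) f S₀
    (fun x hx => Finset.mem_insert_of_mem (by simpa using hx)) (Finset.mem_insert_self _ _) hES
  rw [← ENNReal.ofReal_toReal hE, ← ENNReal.ofReal_mul (by positivity)]
  refine ENNReal.ofReal_le_ofReal ?_
  simp only [mul_zero, Finset.sum_const_zero, sub_zero] at h1
  rw [div_mul_eq_mul_div, le_div_iff₀ hπ]
  rw [← hEdef]
  have h2 : f a ^ 2 * conductanceAt G C a * conductanceAt G C a ≤ Γ * E * conductanceAt G C a := by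
    nlinarith
  exact le_of_mul_le_mul_right h2 hπ

end

/-! ### The Hilbert space of antisymmetric fields -/

/-- The normalised gradient `√C(e) (f(head) - f(tail))`. -/
noncomputable def tension (G : SimpleGraph V) (C : Sym2 V → ℝ) (f : V → ℝ) (d : G.Dart) : ℝ :=
  √(C d.edge) * (f d.snd - f d.fst)

lemma tension_sq (hC : ∀ e ∈ G.edgeSet, 0 < C e) (f : V → ℝ) (d : G.Dart) :
    tension G C f d ^ 2 = C d.edge * (f d.snd - f d.fst) ^ 2 := by
  rw [tension, mul_pow, Real.sq_sqrt (hC _ d.edge_mem).le]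

/-- The functions of finite energy. -/
noncomputable def dirichletSpace (G : SimpleGraph V) (C : Sym2 V → ℝ) : Submodule ℝ (V → ℝ) where
  carrier := {f | Memℓp (tension G C f) 2}
  add_mem' {f g} hf hg := by
    have h : tension G C (f + g) = tension G C f + tension G C g := by
      ext d
      simp only [tension, Pi.add_apply]
      ring
    change Memℓp _ 2
    rw [h]
    exact Memℓp.add hf hg
  zero_mem' := by
    have h : tension G C 0 = 0 := by
      ext d
      simp [tension]
    change Memℓp _ 2
    rw [h]
    exact zero_memℓp
  smul_mem' c f hf := by
    have h : tension G C (c • f) = c • tension G C f := by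
      ext d
      simp only [tension, Pi.smul_apply, smul_eq_mul]
      ring
    change Memℓp _ 2
    rw [h]
    exact Memℓp.const_smul hf c

/-- The normalised gradient as a linear map to a Hilbert space. -/
noncomputable def tensionMap (G : SimpleGraph V) (C : Sym2 V → ℝ) :
    dirichletSpace G C →ₗ[ℝ] lp (fun _ : G.Dart => ℝ) 2 where
  toFun f := ⟨tension G C f, f.2⟩
  map_add' f g := by
    ext d
    simp only [tension, Submodule.coe_add, Pi.add_apply, lp.coeFn_add]
    ring
  map_smul' c f := by
    ext d
    simp only [tension, Submodule.coe_smul, Pi.smul_apply, lp.coeFn_smul, smul_eq_mul,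
      RingHom.id_apply]
    ring

@[simp] lemma tensionMap_apply (f : dirichletSpace G C) (d : G.Dart) :
    tensionMap G C f d = tension G C f d := rfl

lemma sqSum_edgeVar_eq_tension (hC : ∀ e ∈ G.edgeSet, 0 < C e) (f : V → ℝ) :
    sqSum G C (edgeVar f) = ∑' d, ENNReal.ofReal (tension G C f d ^ 2) := by
  rw [sqSum_edgeVar]
  exact tsum_congr fun d => by rw [tension_sq hC]

lemma mem_dirichletSpace (hC : ∀ e ∈ G.edgeSet, 0 < C e) {f : V → ℝ} :
    f ∈ dirichletSpace G C ↔ sqSum G C (edgeVar f) < ⊤ := by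
  change Memℓp (tension G C f) 2 ↔ _
  rw [sqSum_edgeVar_eq_tension hC, memℓp_gen_iff (by norm_num)]
  simp only [ENNReal.toReal_ofNat, Real.rpow_ofNat, Real.norm_eq_abs, sq_abs]
  constructor
  · exact fun h => h.tsum_ofReal_lt_top
  · intro h
    refine (ENNReal.summable_toReal h.ne).congr fun d => ?_
    rw [ENNReal.toReal_ofReal (sq_nonneg _)]

lemma ofReal_norm_tensionMap_sq (hC : ∀ e ∈ G.edgeSet, 0 < C e) (f : dirichletSpace G C) :
    ENNReal.ofReal (‖tensionMap G C f‖ ^ 2) = sqSum G C (edgeVar f) := by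
  have h := lp.norm_rpow_eq_tsum (p := 2) (by norm_num) (tensionMap G C f)
  have hs := (memℓp_gen_iff (p := 2) (by norm_num)).1 f.2
  simp only [ENNReal.toReal_ofNat, Real.rpow_ofNat, Real.norm_eq_abs, sq_abs, tensionMap_apply]
    at h hs
  rw [h, sqSum_edgeVar_eq_tension hC, ENNReal.ofReal_tsum_of_nonneg (fun _ => sq_nonneg _) hs]

lemma abs_sub_le_norm_tensionMap (hC : ∀ e ∈ G.edgeSet, 0 < C e) (f : dirichletSpace G C) {u v : V}
    (h : G.Adj u v) : |(f : V → ℝ) v - (f : V → ℝ) u| ≤ (√(C s(u, v)))⁻¹ * ‖tensionMap G C f‖ := by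
  have h1 := lp.norm_apply_le_norm (by norm_num) (tensionMap G C f) ⟨(u, v), h⟩
  have h2 : 0 < √(C s(u, v)) := Real.sqrt_pos.2 (hC _ h)
  rw [tensionMap_apply, Real.norm_eq_abs, tension, abs_mul, abs_of_nonneg (Real.sqrt_nonneg _)] at h1
  rw [← div_eq_inv_mul, le_div_iff₀ h2, mul_comm]
  exact h1

/-- The finitely supported functions. -/
noncomputable def finSupp (G : SimpleGraph V) (C : Sym2 V → ℝ) :
    Submodule ℝ (dirichletSpace G C) where
  carrier := {f | (f : V → ℝ).support.Finite}
  add_mem' {f g} hf hg := (hf.union hg).subset (Function.support_add _ _)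
  zero_mem' := by simp
  smul_mem' c f hf := hf.subset (Function.support_const_smul_subset c (f : V → ℝ))

/-- The values of finitely supported functions are controlled by the energy. -/
lemma exists_abs_le_norm_tensionMap (hC : ∀ e ∈ G.edgeSet, 0 < C e) {a : V} {K : ℝ≥0∞} (hK : K < ⊤)
    (hcap : ∀ f : V → ℝ, f.support.Finite → ENNReal.ofReal (f a ^ 2) ≤ K * sqSum G C (edgeVar f))
    {v : V} (p : G.Walk v a) :
    ∃ M : ℝ, ∀ f ∈ finSupp G C, |(f : V → ℝ) v| ≤ M * ‖tensionMap G C f‖ := by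
  induction p with
  | @nil a =>
    refine ⟨√K.toReal, fun f hf => ?_⟩
    have h := hcap f hf
    rw [← ofReal_norm_tensionMap_sq hC, ← ENNReal.ofReal_toReal hK.ne,
      ← ENNReal.ofReal_mul ENNReal.toReal_nonneg, ENNReal.ofReal_le_ofReal_iff (by positivity)] at h
    refine abs_le_of_sq_le_sq ?_ (by positivity)
    rwa [mul_pow, Real.sq_sqrt ENNReal.toReal_nonneg]
  | @cons u w a h p ih =>
    obtain ⟨M, hM⟩ := ih hcap
    refine ⟨M + (√(C s(u, w)))⁻¹, fun f hf => ?_⟩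
    have h1 := abs_sub_le_norm_tensionMap hC f h
    have h2 := hM f hf
    have h3 := abs_sub_abs_le_abs_sub ((f : V → ℝ) u) ((f : V → ℝ) w)
    rw [abs_sub_comm] at h3
    linarith

/-! ### Orthogonal projection and the harmonic part. -/

section LocallyFinite

variable [G.LocallyFinite]

lemma finite_setOf_dart_fst (v : V) : {d : G.Dart | d.fst = v}.Finite := by
  refine (Set.finite_range (G.dartOfNeighborSet v)).subset ?_
  rintro ⟨⟨x, y⟩, h⟩ rfl
  exact ⟨⟨y, h⟩, rfl⟩

lemma finite_setOf_dart_snd (v : V) : {d : G.Dart | d.snd = v}.Finite :=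
  (finite_setOf_dart_fst v).preimage (f := SimpleGraph.Dart.symm)
    SimpleGraph.Dart.symm_involutive.injective.injOn

open Classical in
lemma single_mem_dirichletSpace (v : V) : (Pi.single v 1 : V → ℝ) ∈ dirichletSpace G C := by
  refine (memℓp_zero ?_).of_exponent_ge zero_le
  refine ((finite_setOf_dart_fst v).union (finite_setOf_dart_snd v)).subset fun d hd => ?_
  by_contra h
  simp only [Set.mem_union, Set.mem_ofPred_eq, not_or] at h
  exact hd (by simp [tension, h.1, h.2])

-- Only darts at `v` contribute. `F` collects those leaving `v`, and its composition with reversal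
-- those entering; the two sums agree, whence the factor `2`.
open Classical in
lemma inner_tensionMap_single (hC : ∀ e ∈ G.edgeSet, 0 < C e) (h : dirichletSpace G C) (v : V) :
    inner ℝ (tensionMap G C h) (tensionMap G C ⟨Pi.single v 1, single_mem_dirichletSpace v⟩) =
      2 * ∑ w ∈ G.neighborFinset v, C s(v, w) * ((h : V → ℝ) v - (h : V → ℝ) w) := by
  set F : G.Dart → ℝ := fun d =>
    if d.fst = v then C d.edge * ((h : V → ℝ) d.fst - (h : V → ℝ) d.snd) else 0 with hF
  have hfin : F.support.Finite := (finite_setOf_dart_fst v).subset fun d hd => by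
    by_contra h'
    exact hd (if_neg h')
  have hs : Summable F := summable_of_hasFiniteSupport hfin
  have hs' : Summable fun d : G.Dart => F d.symm :=
    (Function.Involutive.toPerm _ (SimpleGraph.Dart.symm_involutive (G := G))).summable_iff.2 hs
  have hsum : ∑' d, F d = ∑ w ∈ G.neighborFinset v, C s(v, w) * ((h : V → ℝ) v - (h : V → ℝ) w) := by
    have hinj : Function.Injective (G.dartOfNeighborSet v) := G.dartOfNeighborSet_injective v
    rw [← hinj.tsum_eq, tsum_fintype, SimpleGraph.neighborFinset, ← Finset.sum_set_coe]
    · exact Finset.sum_congr rfl fun w _ => if_pos rfl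
    · rintro ⟨⟨x, y⟩, hxy⟩ hd
      obtain rfl : x = v := by
        by_contra h'
        exact hd (if_neg h')
      exact ⟨⟨y, hxy⟩, rfl⟩
  have hsum' : ∑' d : G.Dart, F d.symm = ∑' d, F d :=
    (Function.Involutive.toPerm _ (SimpleGraph.Dart.symm_involutive (G := G))).tsum_eq F
  rw [lp.inner_eq_tsum, two_mul, ← hsum]
  nth_rewrite 2 [← hsum']
  rw [← hs.tsum_add hs']
  refine tsum_congr fun d => ?_
  have h1 : √(C d.edge) * √(C d.edge) = C d.edge := Real.mul_self_sqrt (hC _ d.edge_mem).le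
  have h2 : d.symm.edge = d.edge := d.edge_symm
  simp only [tensionMap_apply, tension, hF, h2, SimpleGraph.Dart.symm_toProd, Prod.fst_swap,
    Prod.snd_swap, Pi.single_apply, RCLike.inner_apply, conj_trivial]
  have h3 := d.fst_ne_snd
  split_ifs with h4 h5 h5
  · exact absurd (h5.trans h4.symm) h3
  · linear_combination ((h : V → ℝ) d.snd - (h : V → ℝ) d.fst) * h1
  · linear_combination -((h : V → ℝ) d.snd - (h : V → ℝ) d.fst) * h1
  · ring

/-- The harmonic part of a Dirichlet function on a transient connected network. -/
theorem exists_harmonic_part (hC : ∀ e ∈ G.edgeSet, 0 < C e) (hconn : ∀ u v, G.Reachable u v)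
    (hnb : ∀ v, ∃ w, G.Adj v w) {a : V} {K : ℝ≥0∞} (hK : K < ⊤)
    (hcap : ∀ f : V → ℝ, f.support.Finite → ENNReal.ofReal (f a ^ 2) ≤ K * sqSum G C (edgeVar f))
    {g : V → ℝ} (hg : sqSum G C (edgeVar g) < ⊤) :
    ∃ h : V → ℝ, IsHarmonic G C h ∧ sqSum G C (edgeVar h) < ⊤ ∧
      ∀ b : V, ∀ ε : ℝ, 0 < ε → ∃ f : V → ℝ, f.support.Finite ∧
        sqSum G C (edgeVar (g - h - f)) < ENNReal.ofReal ε ∧ |(g - h - f) b| < ε := by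
  classical
  rw [← mem_dirichletSpace hC] at hg
  set T := tensionMap G C
  -- Royden decomposition: project the gradient of `g` on the closed span of gradients of finitely
  -- supported functions.
  set U := ((finSupp G C).map T).topologicalClosure with hU
  have : CompleteSpace U := (Submodule.isClosed_topologicalClosure _).completeSpace_coe
  obtain ⟨y, hy, z, hz, hyz⟩ := U.exists_add_mem_mem_orthogonal (T ⟨g, hg⟩)
  obtain ⟨u, hu, hlim⟩ := mem_closure_iff_seq_limit.1 hy
  choose f hf hfu using fun n => (Submodule.mem_map.1 (hu n) : ∃ f ∈ finSupp G C, T f = u n)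
  obtain rfl : (fun n => T (f n)) = u := funext hfu
  -- Positive capacity turns convergence of gradients into pointwise convergence, so the projection
  -- is again the gradient of a function `l`.
  have hcauchy : ∀ v, ∃ l : ℝ, Tendsto (fun n => (f n : V → ℝ) v) atTop (𝓝 l) := by
    intro v
    obtain ⟨M, hM⟩ := exists_abs_le_norm_tensionMap hC hK hcap (hconn v a).some
    refine cauchySeq_tendsto_of_complete (cauchySeq_iff_tendsto_dist_atTop_0.2 ?_)
    have h1 := (cauchySeq_iff_tendsto_dist_atTop_0.1 hlim.cauchySeq).const_mul M
    rw [mul_zero] at h1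
    refine squeeze_zero (fun _ => dist_nonneg) (fun n => ?_) h1
    rw [dist_eq_norm, dist_eq_norm, ← map_sub]
    exact hM _ ((finSupp G C).sub_mem (hf n.1) (hf n.2))
  choose l hl using hcauchy
  have hy_eq : ∀ d, y d = tension G C l d := by
    intro d
    have h1 : Tendsto (fun n => T (f n) d) atTop (𝓝 (y d)) := by
      rw [tendsto_iff_norm_sub_tendsto_zero] at hlim ⊢
      refine squeeze_zero (fun _ => norm_nonneg _) (fun n => ?_) hlim
      exact lp.norm_apply_le_norm (by norm_num) (T (f n) - y) d
    exact tendsto_nhds_unique h1 (((hl d.snd).sub (hl d.fst)).const_mul _)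
  have hl_mem : l ∈ dirichletSpace G C := by
    have : tension G C l = y := funext fun d => (hy_eq d).symm
    change Memℓp _ 2
    rw [this]
    exact y.2
  have hyl : y = T ⟨l, hl_mem⟩ := lp.ext (funext hy_eq)
  set h : dirichletSpace G C := ⟨g, hg⟩ - ⟨l, hl_mem⟩ with hh
  have hzh : z = T h := by
    rw [hh, map_sub, hyz, hyl, add_sub_cancel_left]
  refine ⟨h, fun v => ?_, (mem_dirichletSpace hC).1 h.2, fun b ε hε => ?_⟩
  · have h1 := inner_tensionMap_single hC h v
    -- Orthogonality to the gradient of the indicator of `v` is harmonicity at `v`.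
    have h2 : T ⟨Pi.single v 1, single_mem_dirichletSpace v⟩ ∈ U := by
      refine Submodule.le_topologicalClosure _ (Submodule.mem_map_of_mem ?_)
      exact (Set.finite_singleton v).subset Pi.support_single_subset
    rw [← hzh, (Submodule.mem_orthogonal' _ _).1 hz _ h2] at h1
    simp only [mul_sub, Finset.sum_sub_distrib, ← Finset.sum_mul] at h1
    obtain ⟨w, hw⟩ := hnb v
    have h3 := conductanceAt_pos hC hw
    rw [conductanceAt] at h3
    rw [← Finset.sum_div, eq_div_iff h3.ne']
    linarith
  · have h1 : Tendsto (fun n => ‖T (⟨l, hl_mem⟩ - f n)‖ ^ 2) atTop (𝓝 0) := by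
      have := (hlim.const_sub y).norm.pow 2
      simpa [hyl, ← map_sub] using this
    have h2 : Tendsto (fun n => |l b - (f n : V → ℝ) b|) atTop (𝓝 0) := by
      simpa using ((hl b).const_sub (l b)).abs
    obtain ⟨n, hn1, hn2⟩ := ((h1.eventually_lt_const hε).and (h2.eventually_lt_const hε)).exists
    have heq : g - h - f n = ((⟨l, hl_mem⟩ - f n : dirichletSpace G C) : V → ℝ) := by
      simp [hh]
    refine ⟨f n, hf n, ?_, ?_⟩
    · rw [heq, ← ofReal_norm_tensionMap_sq hC]
      exact (ENNReal.ofReal_lt_ofReal_iff hε).2 hn1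
    · rw [heq]
      exact hn2

end LocallyFinite

/-! ### A single metric controlling countably many approximations. -/

lemma edgeVar_nonneg (g : V → ℝ) (e : Sym2 V) : 0 ≤ edgeVar g e := by
  induction e using Sym2.ind with
  | _ u v => exact abs_nonneg _

/-- A square summable edge metric that simultaneously dominates members of countably many classes of
functions, each of which contains functions of arbitrarily small norm. -/
theorem exists_common_metric {ι : Type*} [Countable ι] (hC : ∀ e ∈ G.edgeSet, 0 < C e)
    (𝒢 : ι → Set (V → ℝ)) (a : V)
    (hsmall : ∀ i, ∀ ε : ℝ, 0 < ε → ∃ g ∈ 𝒢 i, sqSum G C (edgeVar g) < ENNReal.ofReal ε ∧ |g a| < ε)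
    {m : Sym2 V → ℝ} (hm : sqSum G C m < ⊤) :
    ∃ Q : Sym2 V → ℝ, (∀ e ∈ G.edgeSet, m e ≤ Q e) ∧ sqSum G C Q < ⊤ ∧
      ∀ i, ∃ g : ℕ → V → ℝ, ∀ k, g k ∈ 𝒢 i ∧ |g k a| ≤ (1 / 2) ^ k ∧
        ∀ e ∈ G.edgeSet, edgeVar (g k) e ≤ (1 / 2) ^ k * Q e := by
  obtain ⟨δ, hδ, hδsum⟩ := ENNReal.exists_pos_sum_of_countable one_ne_zero (ι × ℕ)
  -- The factor `(1/4)^k` absorbs the weight `4^k` in `Q2`, leaving the summable `δ`; the bound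
  -- `(1/2)^k` is for the value at `a`.
  have hε : ∀ p : ι × ℕ, 0 < min ((1 / 2 : ℝ) ^ p.2) ((1 / 4) ^ p.2 * δ p) := fun p =>
    lt_min (by positivity) (mul_pos (by positivity) (hδ p))
  choose g hg𝒢 hg hga using fun p : ι × ℕ => hsmall p.1 _ (hε p)
  -- This is the square of the metric: each summand being at most `Q²` yields `m ≤ Q` and `2^k ·
  -- edgeVar ≤ Q`.
  set Q2 : Sym2 V → ℝ≥0∞ := fun e => ENNReal.ofReal (m e ^ 2) +
    ∑' p : ι × ℕ, ENNReal.ofReal (4 ^ p.2 * edgeVar (g p) e ^ 2) with hQ2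
  have hsum : ∑' d : G.Dart, ENNReal.ofReal (C d.edge) * Q2 d.edge < ⊤ := by
    have h1 : ∑' d : G.Dart, ENNReal.ofReal (C d.edge) * Q2 d.edge =
        sqSum G C m + ∑' p : ι × ℕ, ENNReal.ofReal (4 ^ p.2) * sqSum G C (edgeVar (g p)) := by
      simp only [hQ2, mul_add, ← ENNReal.tsum_mul_left, ENNReal.tsum_add]
      rw [ENNReal.tsum_comm]
      congr 1
      · exact tsum_congr fun d => (ENNReal.ofReal_mul (hC _ d.edge_mem).le).symm
      · refine tsum_congr fun p => ?_
        rw [sqSum, ← ENNReal.tsum_mul_left]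
        refine tsum_congr fun d => ?_
        rw [← ENNReal.ofReal_mul (hC _ d.edge_mem).le, ← ENNReal.ofReal_mul (by positivity)]
        congr 1
        ring
    rw [h1]
    refine ENNReal.add_lt_top.2 ⟨hm, lt_of_le_of_lt (ENNReal.tsum_le_tsum fun p => ?_)
      (hδsum.trans ENNReal.one_lt_top)⟩
    calc ENNReal.ofReal (4 ^ p.2) * sqSum G C (edgeVar (g p))
        ≤ ENNReal.ofReal (4 ^ p.2) * ENNReal.ofReal ((1 / 4) ^ p.2 * δ p) :=
          mul_le_mul_right ((hg p).le.trans (ENNReal.ofReal_le_ofReal (min_le_right _ _))) _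
      _ = ENNReal.ofReal (δ p) := by
          rw [← ENNReal.ofReal_mul (by positivity), ← mul_assoc, ← mul_pow]
          norm_num
      _ = δ p := ENNReal.ofReal_coe_nnreal
  have hfin : ∀ e ∈ G.edgeSet, Q2 e ≠ ⊤ := by
    intro e he htop
    induction e using Sym2.ind with
    | _ u v =>
      refine ENNReal.ne_top_of_tsum_ne_top hsum.ne (⟨(u, v), he⟩ : G.Dart) ?_
      change ENNReal.ofReal (C s(u, v)) * Q2 s(u, v) = ⊤
      rw [htop, ENNReal.mul_top (ENNReal.ofReal_pos.2 (hC _ he)).ne']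
  refine ⟨fun e => √(Q2 e).toReal, fun e he => ?_, ?_, fun i => ⟨fun k => g (i, k), fun k =>
    ⟨hg𝒢 (i, k), (hga (i, k)).le.trans (min_le_left _ _), fun e he => ?_⟩⟩⟩
  · refine Real.le_sqrt_of_sq_le ((ENNReal.ofReal_le_iff_le_toReal (hfin e he)).1 ?_)
    exact le_self_add
  · refine lt_of_le_of_lt (le_of_eq (tsum_congr fun d => ?_)) hsum
    rw [Real.sq_sqrt ENNReal.toReal_nonneg, ENNReal.ofReal_mul (hC _ d.edge_mem).le,
      ENNReal.ofReal_toReal (hfin _ d.edge_mem)]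
  · have h1 : 2 ^ k * edgeVar (g (i, k)) e ≤ √(Q2 e).toReal := by
      refine Real.le_sqrt_of_sq_le ((ENNReal.ofReal_le_iff_le_toReal (hfin e he)).1 ?_)
      refine le_trans (le_of_eq ?_) ((ENNReal.le_tsum (i, k)).trans le_add_self)
      congr 1
      rw [mul_pow, ← pow_mul, mul_comm k, pow_mul]
      norm_num
    rw [one_div, inv_pow, ← div_eq_inv_mul, le_div_iff₀ (by positivity), mul_comm]
    exact h1

/-! ### Rays of finite length in transient networks -/

/-- The vertices that can be reached from `v` by a walk of `Q`-length at most `t`. -/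
def walkBall (G : SimpleGraph V) (Q : Sym2 V → ℝ) (v : V) (t : ℝ) : Set V :=
  {u | ∃ p : G.Walk v u, (p.edges.map Q).sum ≤ t}

lemma sum_edges_nonneg {Q : Sym2 V → ℝ} (hQ : ∀ e ∈ G.edgeSet, 0 ≤ Q e) {u v : V} (p : G.Walk u v) :
    0 ≤ (p.edges.map Q).sum :=
  List.sum_nonneg fun x hx => by
    obtain ⟨e, he, rfl⟩ := List.mem_map.1 hx
    exact hQ e (p.edges_subset_edgeSet he)

/-- König's lemma, one step: a walk from `v` is trivial or starts with one of finitely many edges,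
so some neighbour must inherit an infinite ball with the remaining budget. -/
lemma exists_adj_infinite_walkBall [G.LocallyFinite] {Q : Sym2 V → ℝ} {v : V} {t : ℝ}
    (h : (walkBall G Q v t).Infinite) :
    ∃ w, G.Adj v w ∧ (walkBall G Q w (t - Q s(v, w))).Infinite := by
  by_contra! hw
  refine h (((Set.finite_singleton v).union ((G.neighborFinset v).finite_toSet.biUnion
    fun w hw' => hw w (by simpa using hw'))).subset ?_)
  rintro u ⟨p, hp⟩
  cases p with
  | nil => exact Or.inl rfl
  | @cons _ w _ hadj q =>
    refine Or.inr (Set.mem_biUnion (x := w) (by simpa using hadj) ⟨q, ?_⟩)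
    simp only [SimpleGraph.Walk.edges_cons, List.map_cons, List.sum_cons] at hp
    linarith

lemma exists_ray_of_infinite_walkBall [G.LocallyFinite] {Q : Sym2 V → ℝ}
    (hQ : ∀ e ∈ G.edgeSet, 0 ≤ Q e) {a : V} {N : ℝ} (h : (walkBall G Q a N).Infinite) :
    ∃ x : ℕ → V, x 0 = a ∧ (∀ n, G.Adj (x n) (x (n + 1))) ∧
      Summable fun n => Q s(x n, x (n + 1)) := by
  choose next hadj hinf using fun s : {p : V × ℝ // (walkBall G Q p.1 p.2).Infinite} =>
    exists_adj_infinite_walkBall s.2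
  set s : ℕ → {p : V × ℝ // (walkBall G Q p.1 p.2).Infinite} := fun n =>
    Nat.rec ⟨(a, N), h⟩ (fun _ s => ⟨(next s, s.1.2 - Q s(s.1.1, next s)), hinf s⟩) n with hs
  have hsucc : ∀ n, (s (n + 1)).1 = (next (s n), (s n).1.2 - Q s((s n).1.1, next (s n))) :=
    fun n => rfl
  have hadj' : ∀ n, G.Adj (s n).1.1 (s (n + 1)).1.1 := fun n => by
    rw [hsucc]; exact hadj (s n)
  refine ⟨fun n => (s n).1.1, rfl, hadj', summable_of_sum_range_le (c := N)
    (fun n => hQ _ (hadj' n)) fun n => ?_⟩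
  -- The length used so far is `N` minus the remaining budget, which is nonnegative because the
  -- remaining ball is nonempty.
  have hsum : ∑ i ∈ Finset.range n, Q s((s i).1.1, (s (i + 1)).1.1) = N - (s n).1.2 := by
    induction n with
    | zero => simp [hs]
    | succ n ih =>
      rw [Finset.sum_range_succ, ih, hsucc n]
      ring
  obtain ⟨u, p, hp⟩ := (s n).2.nonempty
  have := sum_edges_nonneg hQ p
  rw [hsum]
  linarith

/-- A network in which some vertex has positive capacity contains, for every square summable metric,
a ray of finite length from that vertex. -/
theorem exists_ray_of_capacity [G.LocallyFinite] (hC : ∀ e ∈ G.edgeSet, 0 < C e)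
    {Q : Sym2 V → ℝ} (hQ : ∀ e ∈ G.edgeSet, 0 ≤ Q e) (hQ' : sqSum G C Q < ⊤)
    {a : V} {K : ℝ≥0∞} (hK : K < ⊤)
    (hcap : ∀ f : V → ℝ, f.support.Finite → ENNReal.ofReal (f a ^ 2) ≤ K * sqSum G C (edgeVar f)) :
    ∃ x : ℕ → V, x 0 = a ∧ (∀ n, G.Adj (x n) (x (n + 1))) ∧
      Summable fun n => Q s(x n, x (n + 1)) := by
  by_contra hno
  have hfin : ∀ N, (walkBall G Q a N).Finite := fun N => by
    by_contra h
    exact hno (exists_ray_of_infinite_walkBall hQ h)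
  have hκ : K * sqSum G C Q ≠ ⊤ := (ENNReal.mul_lt_top hK hQ').ne
  obtain ⟨N, hN⟩ := exists_nat_gt (max 1 (K * sqSum G C Q).toReal)
  have hN1 : 1 < (N : ℝ) := (le_max_left _ _).trans_lt hN
  set ρ : V → ℝ≥0∞ := fun v => ⨅ p : G.Walk a v, ENNReal.ofReal (p.edges.map Q).sum with hρ
  have hρadj : ∀ u v, G.Adj u v → ρ v ≤ ρ u + ENNReal.ofReal (Q s(u, v)) := by
    intro u v huv
    simp only [hρ, ENNReal.iInf_add]
    refine le_iInf fun p => (iInf_le _ (p.concat huv)).trans ?_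
    rw [← ENNReal.ofReal_add (sum_edges_nonneg hQ p) (hQ _ huv)]
    simp [SimpleGraph.Walk.edges_concat]
  set t : V → ℝ := fun v => (min (ρ v) N).toReal with ht
  have hmin : ∀ v, min (ρ v) N ≠ ⊤ := fun v =>
    ((min_le_right _ _).trans_lt (ENNReal.natCast_lt_top N)).ne
  have htadj : ∀ u v, G.Adj u v → t v ≤ t u + Q s(u, v) := by
    intro u v huv
    have h1 : min (ρ v) N ≤ min (ρ u) N + ENNReal.ofReal (Q s(u, v)) := by
      rw [min_add]
      exact min_le_min (hρadj u v huv) le_self_add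
    have h2 := ENNReal.toReal_mono (ENNReal.add_ne_top.2 ⟨hmin u, ENNReal.ofReal_ne_top⟩) h1
    rwa [ENNReal.toReal_add (hmin u) ENNReal.ofReal_ne_top, ENNReal.toReal_ofReal (hQ _ huv)] at h2
  -- With `ρ` the `Q`-distance from `a`, this is `1 - min(ρ, N)/N`. If all balls are finite it is
  -- finitely supported, equals `1` at `a` and has energy at most `N⁻²` times that of `Q`. Capacity
  -- then gives `N² ≤ K · sqSum G C Q < N`, against `N > 1`.
  set w : V → ℝ := fun v => 1 - (N : ℝ)⁻¹ * t v with hw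
  have hwa : w a = 1 := by
    have : ρ a ≤ 0 := (iInf_le _ SimpleGraph.Walk.nil).trans (by simp)
    simp [hw, ht, nonpos_iff_eq_zero.1 this]
  have hsupp : w.support.Finite := by
    refine (hfin N).subset fun v hv => ?_
    have h1 : ρ v < N := by
      by_contra! h
      refine hv ?_
      simp only [hw, ht, min_eq_right h, ENNReal.toReal_natCast]
      rw [inv_mul_cancel₀ (by positivity), sub_self]
    obtain ⟨p, hp⟩ := iInf_lt_iff.1 h1
    refine ⟨p, ?_⟩
    rw [← ENNReal.ofReal_natCast] at hp
    exact ((ENNReal.ofReal_lt_ofReal_iff (by positivity)).1 hp).le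
  have hE : sqSum G C (edgeVar w) ≤ ENNReal.ofReal ((N : ℝ)⁻¹ ^ 2) * sqSum G C Q := by
    rw [← sqSum_const_mul]
    refine sqSum_mono hC fun e he => ?_
    induction e using Sym2.ind with
    | _ u v =>
      have h1 := htadj u v he
      have h2 := htadj v u he.symm
      rw [Sym2.eq_swap] at h2
      rw [edgeVar_mk, abs_abs, abs_mul, abs_of_nonneg (hQ _ he)]
      have h3 : w u - w v = (N : ℝ)⁻¹ * (t v - t u) := by simp only [hw]; ring
      rw [h3, abs_mul]
      gcongr
      exact abs_le.2 ⟨by linarith, by linarith⟩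
  have h1 := (hcap w hsupp).trans (mul_le_mul_right hE K)
  rw [hwa, mul_left_comm, ← ENNReal.ofReal_toReal hκ, ← ENNReal.ofReal_mul (by positivity),
    ENNReal.ofReal_le_ofReal_iff (by positivity), inv_pow, ← div_eq_inv_mul,
    le_div_iff₀ (by positivity)] at h1
  have h2 := (le_max_right _ _).trans_lt hN
  nlinarith

namespace HyperbolicCirclePacking

variable (P : HyperbolicCirclePacking G)

/-- Rays of finite `m`-length converge to a point of the unit circle. -/
theorem exists_tendsto_of_summable {x : ℕ → V} (hx : ∀ n, G.Adj (x n) (x (n + 1)))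
    (hs : Summable fun n => P.m s(x n, x (n + 1))) :
    ∃ ζ : Circle, Tendsto (fun n => P.center (x n)) atTop (𝓝 (ζ : ℂ)) ∧
      Tendsto (fun n => P.distBoundary (x n) ζ) atTop (𝓝 0) := by
  obtain ⟨w, hw⟩ := cauchySeq_tendsto_of_complete
    (cauchySeq_of_dist_le_of_summable (f := fun n => P.center (x n)) _
      (fun n => (P.dist_center (hx n)).le) hs)
  have hw1 : ‖w‖ ≤ 1 := le_of_tendsto' hw.norm fun n => (P.norm_center_lt _).le
  have hw2 : ‖w‖ = 1 := by
    by_contra hne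
    have hlt : ‖w‖ < 1 := lt_of_le_of_ne hw1 hne
    -- An interior limit would keep the ray eventually among finitely many discs, whose radii have a
    -- positive minimum, while the edge lengths tend to zero.
    set K := Metric.closedBall w ((1 - ‖w‖) / 2) with hK
    have hKsub : K ⊆ Metric.ball (0 : ℂ) 1 := by
      intro y hy
      rw [hK, Metric.mem_closedBall, dist_eq_norm] at hy
      rw [mem_ball_zero_iff]
      have := norm_add_le (y - w) w
      rw [sub_add_cancel] at this
      linarith
    have hF := P.locally_finite K (isCompact_closedBall _ _) hKsub
    have hev : ∀ᶠ n in atTop,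
        x n ∈ {v | (Metric.closedBall (P.center v) (P.radius v) ∩ K).Nonempty} := by
      filter_upwards [hw.eventually (Metric.closedBall_mem_nhds w (by linarith : 0 < (1 - ‖w‖) / 2))]
        with n hn
      exact ⟨_, Metric.mem_closedBall_self (P.radius_pos _).le, hn⟩
    obtain ⟨n₀, hn₀⟩ := hev.exists
    obtain ⟨v, -, hv⟩ := Set.exists_min_image _ P.radius hF ⟨_, hn₀⟩
    obtain ⟨n, h1, h2⟩ :=
      (hev.and (hs.tendsto_atTop_zero.eventually_lt_const (P.radius_pos v))).exists
    have h3 := hv _ h1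
    rw [m_mk] at h2
    linarith [P.radius_pos (x (n + 1))]
  refine ⟨⟨w, mem_sphere_zero_iff_norm.2 hw2⟩, hw, ?_⟩
  have hs' : ∑' n, ENNReal.ofReal (P.m s(x n, x (n + 1))) ≠ ⊤ := hs.tsum_ofReal_ne_top
  refine tendsto_of_tendsto_of_tendsto_of_le_of_le tendsto_const_nhds
    (ENNReal.tendsto_sum_nat_add _ hs') (fun _ => zero_le) fun n => ?_
  -- The tail of the ray competes in the infimum defining the boundary distance, so that distance is
  -- at most the tail of a convergent series.
  set γ : InfinitePath G := ⟨fun k => x (k + n), fun k => by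
    rw [Nat.add_right_comm]; exact hx (k + n)⟩ with hγ
  have h1 : P.distBoundary (γ.vertex 0) ⟨w, mem_sphere_zero_iff_norm.2 hw2⟩ ≤ pathLength P.m γ :=
    P.distBoundary_le γ _ ((tendsto_add_atTop_iff_nat n).2 hw)
  have h2 := h1.trans (pathLength_le_tsum P.m γ)
  simp only [hγ, Nat.zero_add] at h2
  refine h2.trans (le_of_eq (tsum_congr fun k => ?_))
  rw [Nat.add_right_comm k 1 n]

end HyperbolicCirclePacking

/-! ### Weak convergence and the zero capacity of boundary points. -/

/-- Bounded sequences in `ℓ²` that converge to zero coordinatewise converge weakly to zero. -/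
lemma tendsto_inner_of_coordinatewise {ι : Type*} {y : ℕ → lp (fun _ : ι => ℝ) 2} {M : ℝ}
    (hM : ∀ n, ‖y n‖ ≤ M) (hy : ∀ i, Tendsto (fun n => y n i) atTop (𝓝 0))
    (p : lp (fun _ : ι => ℝ) 2) : Tendsto (fun n => inner ℝ p (y n)) atTop (𝓝 0) := by
  classical
  have hM0 : 0 ≤ M := (norm_nonneg _).trans (hM 0)
  rw [Metric.tendsto_atTop']
  intro ε hε
  have hsum := lp.hasSum_single (p := 2) (by norm_num) p
  have hδ : 0 < ε / (2 * (M + 1)) := by positivity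
  obtain ⟨F, hF⟩ := (Metric.tendsto_nhds.1 hsum _ hδ).exists
  have hfin : Tendsto (fun n => inner ℝ (∑ i ∈ F, lp.single 2 i (p i)) (y n)) atTop (𝓝 0) := by
    simp only [sum_inner, lp.inner_single_left]
    have := tendsto_finsetSum F fun i _ =>
      (tendsto_const_nhds (x := p i)).inner (𝕜 := ℝ) (hy i)
    simpa using this
  obtain ⟨N, hN⟩ := (Metric.tendsto_atTop'.1 hfin) (ε / 2) (by positivity)
  refine ⟨N, fun n hn => ?_⟩
  have h1 := hN n hn
  rw [dist_zero_right, Real.norm_eq_abs] at h1 ⊢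
  have h2 : |inner ℝ (p - ∑ i ∈ F, lp.single 2 i (p i)) (y n)| ≤ ε / (2 * (M + 1)) * M := by
    refine (abs_real_inner_le_norm _ _).trans ?_
    rw [dist_comm, dist_eq_norm] at hF
    exact mul_le_mul hF.le (hM n) (norm_nonneg _) hδ.le
  have h3 : ε / (2 * (M + 1)) * M ≤ ε / 2 := by
    rw [div_mul_eq_mul_div, div_le_div_iff₀ (by positivity) (by positivity)]
    nlinarith
  have h4 := abs_add_le (inner ℝ (p - ∑ i ∈ F, lp.single 2 i (p i)) (y n))
    (inner ℝ (∑ i ∈ F, lp.single 2 i (p i)) (y n))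
  rw [← inner_add_left, sub_add_cancel] at h4
  linarith

/-- A convex set containing a weak null sequence has vectors of arbitrarily small norm. -/
lemma exists_norm_lt_of_convex {E : Type*} [NormedAddCommGroup E] [InnerProductSpace ℝ E]
    [CompleteSpace E] {S : Set E} (hS : Convex ℝ S) {y : ℕ → E} (hyS : ∀ᶠ n in atTop, y n ∈ S)
    (hy : ∀ p : E, Tendsto (fun n => inner ℝ p (y n)) atTop (𝓝 0)) {ε : ℝ} (hε : 0 < ε) :
    ∃ x ∈ S, ‖x‖ < ε := by
  obtain ⟨n, hn⟩ := hyS.exists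
  -- The point `p` of least norm in the closure satisfies `‖p‖² ≤ ⟪p, y⟫` for all `y ∈ S`; along the
  -- weakly null sequence this forces `p = 0`.
  obtain ⟨p, hp, hmin⟩ := exists_norm_eq_iInf_of_complete_convex
    (⟨_, subset_closure hn⟩ : (closure S).Nonempty) isClosed_closure.isComplete hS.closure 0
  rw [norm_eq_iInf_iff_real_inner_le_zero hS.closure hp] at hmin
  have h1 : ‖p‖ ^ 2 ≤ 0 := by
    refine ge_of_tendsto (hy p) (hyS.mono fun n hn => ?_)
    have := hmin _ (subset_closure hn)
    rw [zero_sub, inner_neg_left, inner_sub_right, real_inner_self_eq_norm_sq] at this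
    linarith
  have h2 : p = 0 := by
    rw [← norm_eq_zero]
    exact pow_eq_zero_iff two_ne_zero |>.1 (le_antisymm h1 (sq_nonneg _))
  obtain ⟨x, hx, hd⟩ := Metric.mem_closure_iff.1 (h2 ▸ hp) ε hε
  exact ⟨x, hx, by simpa using hd⟩

/-- The cutoff equal to `1` on `[0, s]` and to `0` on `[2s, ∞)`. -/
noncomputable def cutoff (s d : ℝ) : ℝ := max 0 (min 1 (2 - d / s))

lemma cutoff_nonneg (s d : ℝ) : 0 ≤ cutoff s d := le_max_left _ _

lemma cutoff_le_one (s d : ℝ) : cutoff s d ≤ 1 := max_le zero_le_one (min_le_left _ _)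

lemma cutoff_eq_one {s d : ℝ} (hs : 0 < s) (h : d ≤ s) : cutoff s d = 1 := by
  have : d / s ≤ 1 := (div_le_one hs).2 h
  rw [cutoff, min_eq_left (by linarith), max_eq_right zero_le_one]

lemma cutoff_eq_zero {s d : ℝ} (hs : 0 < s) (h : 2 * s ≤ d) : cutoff s d = 0 := by
  have : 2 ≤ d / s := (le_div_iff₀ hs).2 h
  exact max_eq_left ((min_le_right _ _).trans (by linarith))

lemma abs_cutoff_sub_le {s : ℝ} (hs : 0 < s) (d d' : ℝ) :
    |cutoff s d - cutoff s d'| ≤ |d - d'| / s := by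
  have h1 := abs_max_sub_max_le_abs (min 1 (2 - d / s)) (min 1 (2 - d' / s)) 0
  have h2 := abs_min_sub_min_le_max 1 (2 - d / s) 1 (2 - d' / s)
  rw [sub_self, abs_zero, max_eq_right (abs_nonneg _)] at h2
  have h3 : |2 - d / s - (2 - d' / s)| = |d - d'| / s := by
    rw [← abs_of_pos hs, ← abs_div, abs_of_pos hs, ← abs_neg]
    congr 1
    ring
  rw [cutoff, cutoff, max_comm 0, max_comm 0]
  exact h1.trans (h2.trans h3.le)

namespace HyperbolicCirclePacking

variable (P : HyperbolicCirclePacking G)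

open Classical in
/-- The radius of `P_v` in units of `s`, truncated at `1`, if `P_v` meets the disc of radius `4s`
about `z`. -/
noncomputable def truncRadius (z : Circle) (s : ℝ) (v : V) : ℝ :=
  if dist (P.center v) z ≤ P.radius v + 4 * s then min 1 (P.radius v / s) else 0

lemma truncRadius_nonneg (z : Circle) {s : ℝ} (hs : 0 < s) (v : V) : 0 ≤ P.truncRadius z s v := by
  rw [truncRadius]
  split_ifs
  · exact le_min zero_le_one (div_pos (P.radius_pos v) hs).le
  · exact le_rfl

/-- Shrink each `P_v` to radius `ρ = s · truncRadius ≤ s`, moving its centre towards `z` so that it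
stays inside `P_v`. A shrunken disc of positive radius lies within `4s + 2ρ ≤ 6s` of `z`, so
comparing areas gives `36`. -/
lemma tsum_truncRadius_sq_le (z : Circle) {s : ℝ} (hs : 0 < s) :
    ∑' v, ENNReal.ofReal (P.truncRadius z s v ^ 2) ≤ 36 := by
  set ρ : V → ℝ := fun v => s * P.truncRadius z s v with hρ
  set c : V → ℂ := fun v => AffineMap.lineMap (P.center v) (z : ℂ)
    ((P.radius v - ρ v) / dist (P.center v) z) with hc
  have hd0 : ∀ v, 0 < dist (P.center v) (z : ℂ) := fun v =>
    (P.radius_pos v).trans (P.radius_lt_dist v z)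
  have hρ0 : ∀ v, 0 ≤ ρ v := fun v => mul_nonneg hs.le (P.truncRadius_nonneg z hs v)
  have hρr : ∀ v, ρ v ≤ P.radius v := by
    intro v
    simp only [hρ, truncRadius]
    split_ifs
    · calc s * min 1 (P.radius v / s) ≤ s * (P.radius v / s) := by gcongr; exact min_le_right _ _
        _ = P.radius v := by field_simp
    · simpa using (P.radius_pos v).le
  have hsub : ∀ v, Metric.ball (c v) (ρ v) ⊆ Metric.ball (P.center v) (P.radius v) := by
    intro v
    refine Metric.ball_subset_ball' ?_
    rw [hc, dist_lineMap_left, Real.norm_of_nonneg (div_nonneg (by linarith [hρr v]) (hd0 v).le),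
      div_mul_cancel₀ _ (hd0 v).ne']
    linarith
  have hsub' : ∀ v, Metric.ball (c v) (ρ v) ⊆ Metric.closedBall (z : ℂ) (6 * s) := by
    intro v
    by_cases h : dist (P.center v) z ≤ P.radius v + 4 * s
    · have h1 : ρ v ≤ s := by
        simp only [hρ, truncRadius, if_pos h]
        exact mul_le_of_le_one_right hs.le (min_le_left _ _)
      refine Metric.ball_subset_closedBall.trans (Metric.closedBall_subset_closedBall' ?_)
      have h2 : (P.radius v - ρ v) / dist (P.center v) (z : ℂ) ≤ 1 :=
        (div_le_one (hd0 v)).2 (by linarith [P.radius_lt_dist v z, hρ0 v])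
      rw [hc, dist_lineMap_right, Real.norm_of_nonneg (by linarith), sub_mul,
        div_mul_cancel₀ _ (hd0 v).ne']
      linarith
    · have : ρ v = 0 := by simp [hρ, truncRadius, if_neg h]
      simp [this]
  have h := tsum_sq_radius_le c ρ hρ0 (fun v w hvw => (P.disjoint_interiors v w hvw).mono (hsub v)
    (hsub w)) z (by positivity) hsub'
  simp only [hρ, mul_pow, ENNReal.ofReal_mul (sq_nonneg s), ENNReal.tsum_mul_left] at h
  rw [mul_comm ((6 : ℝ) ^ 2),
    ENNReal.ofReal_mul (sq_nonneg s)] at h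
  rw [ENNReal.mul_le_mul_iff_right (ENNReal.ofReal_pos.2 (by positivity)).ne' ENNReal.ofReal_ne_top]
    at h
  refine h.trans (le_of_eq ?_)
  norm_num

/-- The cutoff changes only if the nearer centre, say of `u`, is within `2s` of `z`. Then `r_u < 2s`
because `z ∉ P_u`, so both discs pass the `4s` test. The change is at most `1` and at most `(r_u +
r_v)/s`. -/
lemma abs_cutoff_sub_le_truncRadius (z : Circle) {s : ℝ} (hs : 0 < s) {u v : V} (h : G.Adj u v) :
    |cutoff s (dist (P.center u) z) - cutoff s (dist (P.center v) z)| ≤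
      P.truncRadius z s u + P.truncRadius z s v := by
  wlog huv : dist (P.center u) z ≤ dist (P.center v) z generalizing u v
  · rw [abs_sub_comm, add_comm]
    exact this h.symm (le_of_not_ge huv)
  by_cases h2 : 2 * s ≤ dist (P.center u) z
  · rw [cutoff_eq_zero hs h2, cutoff_eq_zero hs (h2.trans huv), sub_self, abs_zero]
    exact add_nonneg (P.truncRadius_nonneg z hs u) (P.truncRadius_nonneg z hs v)
  · push Not at h2
    have hd := P.dist_center h
    rw [m_mk] at hd
    have h3 := P.radius_lt_dist u z
    have h4 := dist_triangle_left (P.center v) (z : ℂ) (P.center u)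
    have hru := P.radius_pos u
    have hrv := P.radius_pos v
    rw [truncRadius, truncRadius, if_pos (by linarith), if_pos (by linarith)]
    have h5 : |cutoff s (dist (P.center u) z) - cutoff s (dist (P.center v) z)| ≤ 1 := by
      have hu := cutoff_nonneg s (dist (P.center u) z)
      have hu' := cutoff_le_one s (dist (P.center u) z)
      have hv := cutoff_nonneg s (dist (P.center v) z)
      have hv' := cutoff_le_one s (dist (P.center v) z)
      exact abs_le.2 ⟨by linarith, by linarith⟩
    have h6 : |cutoff s (dist (P.center u) z) - cutoff s (dist (P.center v) z)| ≤
        P.radius u / s + P.radius v / s := by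
      rw [← add_div, ← hd]
      refine (abs_cutoff_sub_le hs _ _).trans ?_
      gcongr
      exact abs_dist_sub_le _ _ _
    have h7 : 0 < P.radius u / s := by positivity
    have h8 : 0 < P.radius v / s := by positivity
    rcases min_cases 1 (P.radius u / s) with h9 | h9 <;>
      rcases min_cases 1 (P.radius v / s) with h10 | h10 <;> linarith

variable [G.LocallyFinite]

/-- The point is that the bound does not depend on `s`: cutoffs at shrinking scales form a sequence
bounded in energy. -/
lemma sqSum_cutoff_le {D : ℕ} (hD : ∀ v, G.degree v ≤ D) {C₀ : ℝ}
    (hCpos : ∀ e ∈ G.edgeSet, 0 < C e) (hC : ∀ e ∈ G.edgeSet, C e ≤ C₀) (hC₀ : 0 ≤ C₀)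
    (z : Circle) {s : ℝ} (hs : 0 < s) :
    sqSum G C (edgeVar fun v => cutoff s (dist (P.center v) z)) ≤
      ENNReal.ofReal (4 * C₀ * D) * 36 := by
  refine le_trans ?_ ((tsum_dart_add_sq_le hD hC hC₀ (P.truncRadius z s)).trans
    (mul_le_mul_right (P.tsum_truncRadius_sq_le z hs) _))
  refine ENNReal.tsum_le_tsum fun d => ENNReal.ofReal_le_ofReal
    (mul_le_mul_of_nonneg_left ?_ (hCpos _ d.edge_mem).le)
  exact pow_le_pow_left₀ (edgeVar_nonneg _ _) (P.abs_cutoff_sub_le_truncRadius z hs d.adj) 2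

/-- Points of the circle have capacity zero. -/
theorem exists_small_eq_one_near {D : ℕ} (hD : ∀ v, G.degree v ≤ D) {C₀ : ℝ}
    (hCpos : ∀ e ∈ G.edgeSet, 0 < C e) (hC : ∀ e ∈ G.edgeSet, C e ≤ C₀) (hC₀ : 0 ≤ C₀)
    (z : Circle) (a : V) {ε : ℝ} (hε : 0 < ε) :
    ∃ g : V → ℝ, (∃ r : ℝ, 0 < r ∧ ∀ v, dist (P.center v) z < r → g v = 1) ∧
      sqSum G C (edgeVar g) < ENNReal.ofReal ε ∧ |g a| < ε := by
  -- Both conditions are preserved by convex combinations, and the cutoffs satisfy them as soon as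
  -- their scale is small enough to vanish at `a`.
  set X : Set (dirichletSpace G C) := {g | (∃ r : ℝ, 0 < r ∧ ∀ v, dist (P.center v) z < r →
    (g : V → ℝ) v = 1) ∧ (g : V → ℝ) a = 0} with hX
  have hXconv : Convex ℝ X := by
    rintro g ⟨⟨r, hr, hg⟩, hga⟩ g' ⟨⟨r', hr', hg'⟩, hga'⟩ α β _ _ hαβ
    refine ⟨⟨min r r', lt_min hr hr', fun v hv => ?_⟩, ?_⟩
    · simp [hg v (hv.trans_le (min_le_left _ _)), hg' v (hv.trans_le (min_le_right _ _)), hαβ]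
    · simp [hga, hga']
  have hs : ∀ n : ℕ, 0 < 1 / ((n : ℝ) + 1) := fun n => Nat.one_div_pos_of_nat
  have hslim : Tendsto (fun n : ℕ => 2 * (1 / ((n : ℝ) + 1))) atTop (𝓝 0) := by
    simpa using tendsto_one_div_add_atTop_nhds_zero_nat.const_mul (2 : ℝ)
  have hzero : ∀ v, ∀ᶠ n : ℕ in atTop, cutoff (1 / ((n : ℝ) + 1)) (dist (P.center v) z) = 0 := by
    intro v
    filter_upwards [hslim.eventually_lt_const ((P.radius_pos v).trans (P.radius_lt_dist v z))]
      with n hn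
    exact cutoff_eq_zero (hs n) hn.le
  have hbd := fun n => P.sqSum_cutoff_le hD hCpos hC hC₀ z (hs n)
  have hB : ENNReal.ofReal (4 * C₀ * D) * 36 ≠ ⊤ :=
    ENNReal.mul_ne_top ENNReal.ofReal_ne_top (by norm_num)
  set χ : ℕ → dirichletSpace G C := fun n => ⟨fun v => cutoff (1 / ((n : ℝ) + 1))
    (dist (P.center v) z), (mem_dirichletSpace hCpos).2 ((hbd n).trans_lt hB.lt_top)⟩ with hχ
  have hnorm : ∀ n, ‖tensionMap G C (χ n)‖ ≤ √(ENNReal.ofReal (4 * C₀ * D) * 36).toReal := by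
    intro n
    refine Real.le_sqrt_of_sq_le ((ENNReal.ofReal_le_iff_le_toReal hB).1 ?_)
    rw [ofReal_norm_tensionMap_sq hCpos]
    exact hbd n
  have hcoord : ∀ d, Tendsto (fun n => tensionMap G C (χ n) d) atTop (𝓝 0) := by
    intro d
    refine tendsto_const_nhds.congr' ?_
    filter_upwards [hzero d.fst, hzero d.snd] with n h1 h2
    simp only [tensionMap_apply, tension, hχ, h1, h2, sub_self, mul_zero]
  have hmem : ∀ᶠ n in atTop, tensionMap G C (χ n) ∈ tensionMap G C '' X := by
    filter_upwards [hzero a] with n hn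
    exact ⟨_, ⟨⟨_, hs n, fun v hv => cutoff_eq_one (hs n) hv.le⟩, hn⟩, rfl⟩
  -- The cutoffs have bounded, not small, energy. Their gradients tend weakly to zero, so elements
  -- of `X` of small energy exist by Mazur's argument.
  obtain ⟨_, ⟨g, ⟨hg1, hga⟩, rfl⟩, hg⟩ := exists_norm_lt_of_convex
    (hXconv.linear_image (tensionMap G C)) hmem
    (tendsto_inner_of_coordinatewise hnorm hcoord) (Real.sqrt_pos.2 hε)
  refine ⟨g, hg1, ?_, by rw [hga, abs_zero]; exact hε⟩
  rw [← ofReal_norm_tensionMap_sq hCpos, ENNReal.ofReal_lt_ofReal_iff hε]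
  calc ‖tensionMap G C g‖ ^ 2 < √ε ^ 2 := by gcongr
    _ = ε := Real.sq_sqrt hε.le

end HyperbolicCirclePacking

/-! ### Passage to induced subgraphs. -/

lemma edgeVar_neg (g : V → ℝ) : edgeVar (-g) = edgeVar g := by
  ext e
  induction e using Sym2.ind with
  | _ u v =>
    rw [edgeVar_mk, edgeVar_mk, ← abs_neg]
    congr 1
    simp only [Pi.neg_apply]
    ring

lemma edgeVar_comp_val {s : Set V} (f : V → ℝ) :
    edgeVar (fun v : s => f v) = fun e => edgeVar f (e.map Subtype.val) := by
  ext e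
  induction e using Sym2.ind with
  | _ u v => rfl

lemma sqSum_induce_le (s : Set V) (q : Sym2 V → ℝ) :
    sqSum (G.induce s) (fun e => C (e.map Subtype.val)) (fun e => q (e.map Subtype.val)) ≤
      sqSum G C q := by
  refine ENNReal.tsum_comp_le_tsum_of_injective (f := fun d : (G.induce s).Dart =>
    (⟨(d.fst.1, d.snd.1), d.adj⟩ : G.Dart)) ?_ (fun d => ENNReal.ofReal (C d.edge * q d.edge ^ 2))
  rintro ⟨⟨x, y⟩, h⟩ ⟨⟨x', y'⟩, h'⟩ heq
  have h1 : x.1 = x'.1 := congrArg (fun d : G.Dart => d.fst) heq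
  have h2 : y.1 = y'.1 := congrArg (fun d : G.Dart => d.snd) heq
  obtain rfl := Subtype.ext h1
  obtain rfl := Subtype.ext h2
  rfl

/-- Induced subgraphs of locally finite graphs are locally finite. -/
noncomputable abbrev induceLocallyFinite (G : SimpleGraph V) [G.LocallyFinite] (s : Set V) :
    (G.induce s).LocallyFinite := fun v =>
  Fintype.ofInjective (fun w => (⟨w.1.1, w.2⟩ : G.neighborSet v)) fun w w' h => by
    simpa [Subtype.ext_iff] using h

/-! ### Test functions -/

/-- The truncation of `ℓ` at height `k · dist(·, A) - 1`. -/
noncomputable def truncNear (A : Set ℂ) (ℓ : ℂ → ℝ) (k : ℕ) (x : ℂ) : ℝ :=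
  max (-max 0 (k * Metric.infDist x A - 1)) (min (max 0 (k * Metric.infDist x A - 1)) (ℓ x))

lemma exists_lipschitzWith_truncNear (A : Set ℂ) {ℓ : ℂ → ℝ} (hℓ : LipschitzWith 1 ℓ) (k : ℕ) :
    ∃ L, LipschitzWith L (truncNear A ℓ k) := by
  have h1 : LipschitzWith k fun x : ℂ => k * Metric.infDist x A - 1 := by
    refine LipschitzWith.of_dist_le_mul fun x y => ?_
    rw [Real.dist_eq, sub_sub_sub_cancel_right, ← mul_sub, abs_mul, Nat.abs_cast,
      NNReal.coe_natCast]
    gcongr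
    simpa [Real.dist_eq] using (Metric.lipschitz_infDist_pt A).dist_le_mul x y
  have h2 := (LipschitzWith.const (0 : ℝ) (α := ℂ)).max h1
  exact ⟨_, h2.neg.max (h2.min hℓ)⟩

lemma truncNear_eq_zero {A : Set ℂ} (ℓ : ℂ → ℝ) (k : ℕ) {x z : ℂ} (hz : z ∈ A)
    (h : dist x z < 1 / ((k : ℝ) + 1)) : truncNear A ℓ k x = 0 := by
  have h1 := Metric.infDist_le_dist_of_mem (x := x) hz
  have h2 : (k : ℝ) * Metric.infDist x A - 1 ≤ 0 := by
    rw [lt_div_iff₀ (by positivity)] at h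
    nlinarith [Metric.infDist_nonneg (x := x) (s := A), (Nat.cast_nonneg k : (0 : ℝ) ≤ k)]
  rw [truncNear, max_eq_left h2, neg_zero]
  exact max_eq_left (min_le_left _ _)

/-- Off the closed set `A` the truncation height tends to infinity, hence exceeds the bound `1` on
`|ℓ x|`. -/
lemma eventually_truncNear_eq {A : Set ℂ} (hA : IsClosed A) (hAne : A.Nonempty) {ℓ : ℂ → ℝ}
    {x : ℂ} (hx : x ∉ A) (hℓ : |ℓ x| ≤ 1) : ∀ᶠ k in atTop, truncNear A ℓ k x = ℓ x := by
  have hpos := (hA.notMem_iff_infDist_pos hAne).1 hx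
  filter_upwards [(tendsto_natCast_atTop_atTop.atTop_mul_const hpos).eventually_ge_atTop (2 : ℝ)]
    with k hk
  obtain ⟨h1, h2⟩ := abs_le.1 hℓ
  rw [truncNear, max_eq_right (by linarith : (0 : ℝ) ≤ k * Metric.infDist x A - 1),
    min_eq_right (by linarith), max_eq_right (by linarith)]

/-- The two coordinates of the plane. -/
def planeCoord : Bool → ℂ → ℝ
  | true => Complex.re
  | false => Complex.im

lemma lipschitzWith_planeCoord (i : Bool) : LipschitzWith 1 (planeCoord i) := by
  refine LipschitzWith.of_dist_le_mul fun x y => ?_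
  rw [NNReal.coe_one, one_mul, Real.dist_eq, dist_eq_norm]
  cases i
  · exact Complex.abs_im_le_norm (x - y)
  · exact Complex.abs_re_le_norm (x - y)

lemma abs_planeCoord_le (i : Bool) (z : Circle) : |planeCoord i z| ≤ 1 := by
  rw [← Circle.norm_coe z]
  cases i
  · exact Complex.abs_im_le_norm _
  · exact Complex.abs_re_le_norm _

/-- Two points with these coordinates agree. This fixes the only candidate endpoint from the
constants alone, before the metric and the ray are chosen; if there is no candidate, any point
serves. -/
lemma exists_circle_unique_limit (c : Bool → ℕ → ℝ) :
    ∃ z₀ : Circle, ∀ z : Circle, (∀ i, ∀ᶠ k in atTop, planeCoord i z = c i k) → z = z₀ := by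
  by_cases h : ∃ z₀ : Circle, ∀ i, ∀ᶠ k in atTop, planeCoord i z₀ = c i k
  · obtain ⟨z₀, hz₀⟩ := h
    refine ⟨z₀, fun z hz => ?_⟩
    have h1 : ∀ i, planeCoord i z = planeCoord i z₀ := fun i => by
      obtain ⟨k, hk, hk'⟩ := ((hz i).and (hz₀ i)).exists
      rw [hk, hk']
    exact Circle.ext (Complex.ext (h1 true) (h1 false))
  · exact ⟨1, fun z hz => absurd ⟨z, hz⟩ h⟩

lemma abs_sub_le_of_summable {Q : Sym2 V → ℝ} (hQ : ∀ e ∈ G.edgeSet, 0 ≤ Q e) {y : ℕ → V}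
    (hy : ∀ n, G.Adj (y n) (y (n + 1))) (hs : Summable fun n => Q s(y n, y (n + 1)))
    {g : V → ℝ} {c : ℝ} (hc : 0 ≤ c) (hg : ∀ e ∈ G.edgeSet, edgeVar g e ≤ c * Q e) (n : ℕ) :
    |g (y n)| ≤ |g (y 0)| + c * ∑' n, Q s(y n, y (n + 1)) := by
  have h1 := dist_le_range_sum_of_dist_le (f := fun n => g (y n)) n
    (d := fun k => c * Q s(y k, y (k + 1))) fun {k} _ => hg s(y k, y (k + 1)) (hy k)
  rw [← Finset.mul_sum, Real.dist_eq, abs_sub_comm] at h1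
  have h2 := mul_le_mul_of_nonneg_left
    (hs.sum_le_tsum (Finset.range n) fun k _ => hQ _ (hy k)) hc
  have h3 := abs_sub_abs_le_abs_sub (g (y n)) (g (y 0))
  linarith

lemma nonpos_of_le_half_pow_mul {x M : ℝ} (h : ∀ k : ℕ, x ≤ (1 / 2) ^ k * M) : x ≤ 0 := by
  have := (tendsto_pow_atTop_nhds_zero_of_lt_one (by norm_num : (0 : ℝ) ≤ 1 / 2)
    (by norm_num)).mul_const M
  rw [zero_mul] at this
  exact ge_of_tendsto' this h

/-! ### The nonconstant harmonic function. -/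

namespace HyperbolicCirclePacking

variable (P : HyperbolicCirclePacking G)

/-- Positive capacity in `G \ W` gives a ray of finite `Q`-length there. As `m ≤ Q`, it converges to
some `ζ` in the sense of `m` as well; were `ζ` in `A`, the ray would enter the neighbourhood `W`. -/
lemma exists_ray_off [G.LocallyFinite] (hCpos : ∀ e ∈ G.edgeSet, 0 < C e) {A : Set Circle}
    {W : Set V} (hW : ∀ z ∈ A, P.IsNbhd z W) {a : (Wᶜ : Set V)} {K : ℝ≥0∞} (hK : K < ⊤)
    (hcap : ∀ f : (Wᶜ : Set V) → ℝ, f.support.Finite → ENNReal.ofReal (f a ^ 2) ≤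
      K * sqSum (G.induce Wᶜ) (fun e => C (e.map Subtype.val)) (edgeVar f))
    {Q : Sym2 V → ℝ} (hmQ : ∀ e ∈ G.edgeSet, P.m e ≤ Q e) (hQ : sqSum G C Q < ⊤) :
    ∃ (y : ℕ → V) (ζ : Circle), y 0 = a ∧ (∀ n, G.Adj (y n) (y (n + 1))) ∧
      (Summable fun n => Q s(y n, y (n + 1))) ∧
      Tendsto (fun n => P.center (y n)) atTop (𝓝 (ζ : ℂ)) ∧ ζ ∉ A := by
  classical
  have := induceLocallyFinite G Wᶜ
  have hCpos' : ∀ e ∈ (G.induce (Wᶜ : Set V)).edgeSet, 0 < C (e.map Subtype.val) := by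
    intro e he
    induction e using Sym2.ind with
    | _ u v => exact hCpos _ he
  have hQ0 : ∀ e ∈ (G.induce (Wᶜ : Set V)).edgeSet, 0 ≤ Q (e.map Subtype.val) := by
    intro e he
    induction e using Sym2.ind with
    | _ u v => exact (P.m_pos _).le.trans (hmQ _ he)
  obtain ⟨x, hx0, hx, hs⟩ := exists_ray_of_capacity hCpos' hQ0
    ((sqSum_induce_le Wᶜ Q).trans_lt hQ) hK hcap
  have hadj : ∀ n, G.Adj (x n) (x (n + 1)) := hx
  obtain ⟨ζ, hζ, hζ'⟩ := P.exists_tendsto_of_summable hadj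
    (Summable.of_nonneg_of_le (fun n => (P.m_pos _).le) (fun n => hmQ _ (hadj n)) hs)
  refine ⟨fun n => x n, ζ, congrArg Subtype.val hx0, hadj, hs, hζ, fun hζA => ?_⟩
  obtain ⟨r, hr, hrW⟩ := hW ζ hζA
  obtain ⟨n, hn⟩ := (hζ'.eventually_lt_const hr).exists
  exact (x n).2 (hrW _ hn)

/-- Finitely supported functions vanish eventually along rays that leave the disc. -/
lemma eventually_eq_zero_of_finite_support {y : ℕ → V} {ζ : Circle}
    (hy : Tendsto (fun n => P.center (y n)) atTop (𝓝 (ζ : ℂ))) {f : V → ℝ}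
    (hf : f.support.Finite) : ∀ᶠ n in atTop, f (y n) = 0 := by
  have h1 : ∀ v ∈ f.support, ∀ᶠ n in atTop, y n ≠ v := by
    intro v _
    have : P.center v ≠ ζ := fun h => by
      have h1 := P.radius_lt_dist v ζ
      rw [h, dist_self] at h1
      exact (P.radius_pos v).not_gt h1
    filter_upwards [hy.eventually_ne this.symm] with n hn h
    exact hn (by rw [h])
  filter_upwards [(Set.Finite.eventually_all hf).2 h1] with n hn
  by_contra h
  exact hn _ h rfl

/-- A network that is transient off a neighbourhood of `A` carries a nonconstant harmonic Dirichlet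
function that is a limit of Dirichlet functions vanishing near `A`. -/
theorem exists_nonconstant_harmonic [G.LocallyFinite] {D : ℕ} (hD : ∀ v, G.degree v ≤ D) {C₀ : ℝ}
    (hCpos : ∀ e ∈ G.edgeSet, 0 < C e) (hC : ∀ e ∈ G.edgeSet, C e ≤ C₀) (hC₀ : 0 ≤ C₀)
    (hconn : ∀ u v, G.Reachable u v) (hnb : ∀ v, ∃ w, G.Adj v w) (b₀ : V)
    {A : Set Circle} (hAne : A.Nonempty) (hA : IsClosed A)
    {W : Set V} (hW : ∀ z ∈ A, P.IsNbhd z W) (htr : IsTransientOff G C W) :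
    ∃ h : V → ℝ, (¬ ∃ c : ℝ, ∀ v, h v = c) ∧ IsHarmonic G C h ∧ sqSum G C (edgeVar h) < ⊤ ∧
      ∀ ε : ℝ, 0 < ε → ∃ g : V → ℝ, sqSum G C (edgeVar g) < ⊤ ∧ P.VanishesNear A g ∧
        sqSum G C (edgeVar (h - g)) < ENNReal.ofReal ε ∧ |(h - g) b₀| < ε := by
  classical
  obtain ⟨a, K, hK, hcapH⟩ : ∃ a : (Wᶜ : Set V), ∃ K : ℝ≥0∞, K < ⊤ ∧
      ∀ f : (Wᶜ : Set V) → ℝ, f.support.Finite → ENNReal.ofReal (f a ^ 2) ≤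
        K * sqSum (G.induce Wᶜ) (fun e => C (e.map Subtype.val)) (edgeVar f) := by
    have := induceLocallyFinite G Wᶜ
    refine IsTransient.exists_capacity (fun e he => ?_) htr
    induction e using Sym2.ind with
    | _ u v => exact hCpos _ he
  -- Restriction to a subgraph only lowers energy, so positive capacity passes from `G \ W` to `G`.
  have hcap : ∀ f : V → ℝ, f.support.Finite →
      ENNReal.ofReal (f a ^ 2) ≤ K * sqSum G C (edgeVar f) := by
    intro f hf
    refine (hcapH (fun v => f v) (hf.preimage Subtype.val_injective.injOn)).trans ?_
    rw [edgeVar_comp_val]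
    exact mul_le_mul_right (sqSum_induce_le Wᶜ _) K
  set A' : Set ℂ := (↑) '' A with hA'
  have hA'closed : IsClosed A' := (hA.isCompact.image continuous_subtype_val).isClosed
  set Φ : Bool → ℕ → V → ℝ := fun i k v => truncNear A' (planeCoord i) k (P.center v) with hΦ
  have hΦcont : ∀ i k, Continuous (truncNear A' (planeCoord i) k) := fun i k =>
    (exists_lipschitzWith_truncNear A' (lipschitzWith_planeCoord i) k).choose_spec.continuous
  have hΦfin : ∀ i k, sqSum G C (edgeVar (Φ i k)) < ⊤ := by
    intro i k
    obtain ⟨L, hL⟩ := exists_lipschitzWith_truncNear A' (lipschitzWith_planeCoord i) k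
    exact P.sqSum_edgeVar_lipschitz_lt_top hD hCpos hC hC₀ hL
  have hΦA : ∀ i k, P.VanishesNear A (Φ i k) := fun i k =>
    P.vanishesNear_comp_center (r := 1 / ((k : ℝ) + 1)) (by positivity) fun x z hz hxz =>
      truncNear_eq_zero _ k (Set.mem_image_of_mem _ hz) hxz
  choose h hharm hfin happ using fun i k =>
    exists_harmonic_part hCpos hconn hnb hK hcap (hΦfin i k)
  by_contra hno
  have hconst : ∀ i k, ∃ c, ∀ v, h i k v = c := by
    intro i k
    by_contra hc
    refine hno ⟨h i k, hc, hharm i k, hfin i k, fun ε hε => ?_⟩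
    obtain ⟨f, hf, hf1, hf2⟩ := happ i k b₀ ε hε
    -- The approximants are `Φ i k - f` with `f` finitely supported; both terms vanish near `A`.
    have heq : h i k - (Φ i k - f) = -(Φ i k - h i k - f) := by abel
    refine ⟨Φ i k - f, ?_, (hΦA i k).sub P (P.vanishesNear_of_finite_support A hf), ?_, ?_⟩
    · have h1 := (mem_dirichletSpace hCpos).2 (hfin i k)
      have h2 := (mem_dirichletSpace hCpos).2 (hf1.trans ENNReal.ofReal_lt_top)
      have h3 := (dirichletSpace G C).add_mem h1 h2
      rw [mem_dirichletSpace hCpos] at h3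
      convert! h3 using 3
      abel
    · rwa [heq, edgeVar_neg]
    · rwa [heq, Pi.neg_apply, abs_neg]
  choose c hc using hconst
  obtain ⟨z₀, hz₀⟩ := exists_circle_unique_limit c
  -- The index `none` serves to exclude the endpoint `z₀`; the others force `Φ i k` to tend to `c i
  -- k` along the ray.
  set 𝒢 : Option (Bool × ℕ) → Set (V → ℝ) := fun t => t.elim
    {g | ∃ r : ℝ, 0 < r ∧ ∀ v, dist (P.center v) z₀ < r → g v = 1}
    fun p => {g | ∃ f : V → ℝ, f.support.Finite ∧ ∀ v, g v = Φ p.1 p.2 v - c p.1 p.2 - f v} with h𝒢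
  obtain ⟨Q, hmQ, hQfin, hQ⟩ := exists_common_metric hCpos 𝒢 (a : V) (by
    rintro (_ | ⟨i, k⟩) ε hε
    · exact P.exists_small_eq_one_near hD hCpos hC hC₀ z₀ a hε
    · obtain ⟨f, hf, hf1, hf2⟩ := happ i k a ε hε
      exact ⟨_, ⟨f, hf, fun v => by simp [hc]⟩, hf1, hf2⟩) (P.sqSum_m_lt_top hD hC hC₀)
  have hQ0 : ∀ e ∈ G.edgeSet, 0 ≤ Q e := fun e he => (P.m_pos e).le.trans (hmQ e he)
  obtain ⟨y, ζ, hy0, hy, hys, hyζ, hζA⟩ := P.exists_ray_off hCpos hW hK hcapH hmQ hQfin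
  set M := 1 + ∑' n, Q s(y n, y (n + 1)) with hM
  have hbound : ∀ t, ∀ k : ℕ, ∃ g ∈ 𝒢 t, ∀ n, |g (y n)| ≤ (1 / 2) ^ k * M := by
    intro t k
    obtain ⟨g, hg⟩ := hQ t
    obtain ⟨hg1, hg2, hg3⟩ := hg k
    refine ⟨g k, hg1, fun n => ?_⟩
    have h1 := abs_sub_le_of_summable hQ0 hy hys (by positivity) hg3 n
    rw [hy0] at h1
    rw [hM, mul_add, mul_one]
    linarith
  -- Far along the ray the finitely supported correction vanishes, so `|Φ i k - c i k|` is
  -- eventually at most `2⁻ʲ M` for each `j`.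
  have hΦζ : ∀ i k, truncNear A' (planeCoord i) k ζ = c i k := by
    intro i k
    refine sub_eq_zero.1 (abs_nonpos_iff.1 (nonpos_of_le_half_pow_mul (M := M) fun j => ?_))
    obtain ⟨g, ⟨f, hf, hgf⟩, hg⟩ := hbound (some (i, k)) j
    have h1 : Tendsto (fun n => |Φ i k (y n) - c i k|) atTop
        (𝓝 |truncNear A' (planeCoord i) k ζ - c i k|) :=
      ((((hΦcont i k).tendsto _).comp hyζ).sub_const _).abs
    refine le_of_tendsto h1 ?_
    filter_upwards [P.eventually_eq_zero_of_finite_support hyζ hf] with n hn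
    have h2 := hg n
    rwa [hgf, hn, sub_zero] at h2
  have hζz : ζ = z₀ := by
    refine hz₀ ζ fun i => ?_
    have hζA' : (ζ : ℂ) ∉ A' := by
      rintro ⟨w, hw, hwζ⟩
      exact hζA (Circle.ext hwζ ▸ hw)
    filter_upwards [eventually_truncNear_eq hA'closed (hAne.image _) hζA' (abs_planeCoord_le i ζ)]
      with k hk
    rw [← hk, hΦζ]
  -- Near `z₀` the dominated functions equal `1`, yet along the ray they are at most `2⁻ʲ M`.
  refine absurd (nonpos_of_le_half_pow_mul (x := 1) (M := M) fun j => ?_) (by norm_num)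
  obtain ⟨g, ⟨r, hr, hgr⟩, hg⟩ := hbound none j
  obtain ⟨n, hn⟩ := (hyζ.eventually (Metric.ball_mem_nhds _ hr)).exists
  have h1 := hg n
  rwa [hgr _ (hζz ▸ hn), abs_one] at h1

/-! ### Boundary values along almost every path, and the conclusion. -/

/-- Limits of functions vanishing near `A` tend to zero along almost every path to `A`. -/
theorem forAlmostEveryPath_tendsto_zero (hCpos : ∀ e ∈ G.edgeSet, 0 < C e)
    (hm : sqSum G C P.m < ⊤) (hconn : ∀ u v, G.Reachable u v) (b₀ : V) {A : Set Circle} {f : V → ℝ}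
    (hf : ∀ ε : ℝ, 0 < ε → ∃ g : V → ℝ, P.VanishesNear A g ∧
      sqSum G C (edgeVar (f - g)) < ENNReal.ofReal ε ∧ |(f - g) b₀| < ε) :
    ForAlmostEveryPath G C (P.pathsTo A)
      (fun γ => Tendsto (fun n => f (γ.vertex n)) atTop (𝓝 0)) := by
  obtain ⟨Q, hmQ, hQfin, hQ⟩ := exists_common_metric (ι := Unit) hCpos
    (fun _ => {g' | ∃ g, P.VanishesNear A g ∧ g' = f - g}) b₀ (fun _ ε hε => by
      obtain ⟨g, hg, hg1, hg2⟩ := hf ε hε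
      exact ⟨_, ⟨g, hg, rfl⟩, hg1, hg2⟩) hm
  have hQpos : ∀ e ∈ G.edgeSet, 0 < Q e := fun e he => (P.m_pos e).trans_le (hmQ e he)
  obtain ⟨g', hg'⟩ := hQ ()
  have hlen : ∀ γ ∈ {γ ∈ P.pathsTo A | ¬ Tendsto (fun n => f (γ.vertex n)) atTop (𝓝 0)},
      pathLength Q γ = ⊤ := by
    rintro γ ⟨⟨z, hz, hγz⟩, hγ⟩
    by_contra hfin
    refine hγ ?_
    set p := (hconn (γ.vertex 0) b₀).some
    set M := 1 + (p.edges.map Q).sum + (pathLength Q γ).toReal with hM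
    -- Near `z` the function `g` vanishes, so `f` equals the difference `g' k` there. That
    -- difference is small at `b₀` and varies by at most `2⁻ᵏ` times the `Q`-length from `b₀` to the
    -- start and along `γ`.
    have hbd : ∀ k, ∀ᶠ n in atTop, |f (γ.vertex n)| ≤ (1 / 2) ^ k * M := by
      intro k
      obtain ⟨⟨g, hg, hgf⟩, hgb, hgQ⟩ := hg' k
      obtain ⟨W, ⟨r, hr, hrW⟩, hgW⟩ := hg z hz
      filter_upwards [hγz.eventually_lt_const hr] with n hn
      have hgn : g (γ.vertex n) = 0 := by
        by_contra h
        exact (hgW ▸ (⟨h, hrW _ hn⟩ : γ.vertex n ∈ Function.support g ∩ W) :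
          γ.vertex n ∈ (∅ : Set V))
      have hadj : ∀ u v, G.Adj u v → dist (g' k u) (g' k v) ≤ (1 / 2) ^ k * Q s(u, v) :=
        fun u v huv => hgQ s(u, v) huv
      have h1 := edist_le_pathLength (q := fun e => (1 / 2) ^ k * Q e) hadj γ n
      rw [pathLength_const_mul (by positivity), edist_dist, ← ENNReal.ofReal_toReal hfin,
        ← ENNReal.ofReal_mul (by positivity), ENNReal.ofReal_le_ofReal_iff (by positivity),
        Real.dist_eq] at h1
      have h2 := dist_le_sum_edges (q := fun e => (1 / 2) ^ k * Q e) hadj p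
      rw [List.sum_map_mul_left, Real.dist_eq] at h2
      have h3 : f (γ.vertex n) = g' k (γ.vertex n) := by simp [hgf, hgn]
      have h4 := abs_sub_abs_le_abs_sub (g' k (γ.vertex n)) (g' k (γ.vertex 0))
      have h5 := abs_sub_abs_le_abs_sub (g' k (γ.vertex 0)) (g' k b₀)
      rw [abs_sub_comm] at h4
      rw [h3, hM, mul_add, mul_add, mul_one]
      linarith
    rw [Metric.tendsto_atTop']
    intro ε hε
    have hlim := (tendsto_pow_atTop_nhds_zero_of_lt_one (by norm_num : (0 : ℝ) ≤ 1 / 2)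
      (by norm_num)).mul_const M
    rw [zero_mul] at hlim
    obtain ⟨k, hk⟩ := (hlim.eventually_lt_const hε).exists
    obtain ⟨N, hN⟩ := eventually_atTop.1 (hbd k)
    refine ⟨N, fun n hn => ?_⟩
    rw [Real.dist_0_eq_abs]
    exact (hN n hn.le).trans_lt hk
  have hnorm : metricNormSq G C Q < ⊤ := (metricNormSq_le_sqSum Q).trans_lt hQfin
  rw [ForAlmostEveryPath, extremalLength, eq_top_iff]
  -- The metric `Q` alone witnesses infinite extremal length: all exceptional paths are infinitely
  -- long in it, and its norm is finite.
  refine le_iSup_of_le Q (le_iSup_of_le hQpos (le_iSup_of_le hnorm ?_))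
  rw [iInf₂_eq_top.2 hlen, ENNReal.top_pow two_ne_zero, ENNReal.top_div_of_lt_top hnorm]

end HyperbolicCirclePacking

/-- The energy and the squared value at `b₀` each receive half of `ε²`; since `|u b₀| ≤ 1`, its
square is no larger than itself. -/
lemma dirichletNorm_lt (hC : ∀ e ∈ G.edgeSet, 0 < C e) (b₀ : V) {ε : ℝ} (hε : 0 < ε) (hε1 : ε ≤ 1)
    {u : V → ℝ} (h1 : sqSum G C (edgeVar u) < ENNReal.ofReal (ε ^ 2 / 2)) (h2 : |u b₀| < ε ^ 2 / 2) :
    dirichletNorm G C b₀ u < ENNReal.ofReal ε := by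
  have h3 : energy G C (gradient G C u) < ENNReal.ofReal (ε ^ 2 / 2) := by
    rw [energy_gradient hC]
    refine lt_of_le_of_lt ?_ h1
    exact mul_le_of_le_one_left' (by simp)
  have h4 : ENNReal.ofReal (|u b₀| ^ 2) ≤ ENNReal.ofReal (ε ^ 2 / 2) := by
    refine ENNReal.ofReal_le_ofReal ?_
    have : |u b₀| ≤ 1 := by nlinarith
    nlinarith [abs_nonneg (u b₀)]
  have h5 : energy G C (gradient G C u) + ENNReal.ofReal (|u b₀| ^ 2) < ENNReal.ofReal (ε ^ 2) := by
    rw [← add_halves (ε ^ 2), ENNReal.ofReal_add (by positivity) (by positivity)]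
    exact ENNReal.add_lt_add_of_lt_of_le ENNReal.ofReal_ne_top h3 h4
  have h6 := ENNReal.rpow_lt_rpow h5 (by norm_num : (0 : ℝ) < 1 / 2)
  rw [dirichletNorm]
  refine h6.trans_le (le_of_eq ?_)
  rw [ENNReal.ofReal_rpow_of_pos (by positivity), ← Real.sqrt_eq_rpow, Real.sqrt_sq hε.le]

lemma IsThreeConnected.exists_adj (h : IsThreeConnected G) (v : V) : ∃ w, G.Adj v w := by
  have : Nontrivial V := by
    rw [← ENat.one_lt_card_iff_nontrivial]
    exact lt_of_lt_of_le (by norm_num) h.1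
  obtain ⟨w, hw⟩ := exists_ne v
  obtain ⟨p⟩ := h.reachable v w
  cases p with
  | nil => exact absurd rfl hw
  | cons hadj _ => exact ⟨_, hadj⟩

end CirclePackedNetwork

theorem mainTheorem7 {V : Type*} (G : SimpleGraph V) [G.LocallyFinite]
    (hconn : CirclePackedNetwork.IsThreeConnected G)
    (hdeg : ∃ D : ℕ, ∀ v, G.degree v ≤ D)
    (htrans : CirclePackedNetwork.IsTransient G (fun _ => 1))
    (P : CirclePackedNetwork.HyperbolicCirclePacking G)
    (C : Sym2 V → ℝ)
    (hCpos : ∀ e ∈ G.edgeSet, 0 < C e)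
    (hCbdd : ∃ C₀ : ℝ, ∀ e ∈ G.edgeSet, C e ≤ C₀)
    (b₀ : V)
    (A : Set Circle) (hAne : A.Nonempty) (hAproper : A ≠ Set.univ) (hAclosed : IsClosed A)
    (hA : ∃ W : Set V, (∀ z ∈ A, P.IsNbhd z W) ∧ CirclePackedNetwork.IsTransientOff G C W) :
    ∃ f : V → ℝ,
      (¬ ∃ c : ℝ, ∀ v, f v = c) ∧
      CirclePackedNetwork.IsHarmonic G C f ∧
      CirclePackedNetwork.IsDirichlet G C f ∧
      CirclePackedNetwork.gradient G C f ∈ P.S C b₀ A ∧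
      f ∈ P.R C b₀ A ∧
      CirclePackedNetwork.ForAlmostEveryPath G C (P.pathsTo A)
        (fun γ => Filter.Tendsto (fun n => f (γ.vertex n)) Filter.atTop (nhds 0)) := by
  obtain ⟨D, hD⟩ := hdeg
  obtain ⟨C₀, hC₀⟩ := hCbdd
  obtain ⟨W, hW, htr⟩ := hA
  have hC : ∀ e ∈ G.edgeSet, C e ≤ max C₀ 0 := fun e he => (hC₀ e he).trans (le_max_left _ _)
  obtain ⟨f, hf, hharm, hfin, happ⟩ := P.exists_nonconstant_harmonic hD hCpos hC (le_max_right _ _)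
    hconn.reachable hconn.exists_adj b₀ hAne hAclosed hW htr
  have hdir := (CirclePackedNetwork.isDirichlet_iff hCpos f).2 hfin
  have hR : f ∈ P.R C b₀ A := by
    refine ⟨hharm, hdir, fun ε hε => ?_⟩
    -- The tolerance `ε` may be infinite, and `dirichletNorm_lt` needs a real one at most `1`.
    set δ := (min ε 1).toReal with hδ
    have hmin : min ε 1 ≠ ⊤ := ((min_le_right _ _).trans_lt ENNReal.one_lt_top).ne
    have hδ0 : 0 < δ := ENNReal.toReal_pos (lt_min hε one_pos).ne' hmin
    have hδ1 : δ ≤ 1 := ENNReal.toReal_mono ENNReal.one_ne_top (min_le_right ε 1)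
    obtain ⟨g, hg, hgA, hg1, hg2⟩ := happ (δ ^ 2 / 2) (by positivity)
    refine ⟨g, (CirclePackedNetwork.isDirichlet_iff hCpos g).2 hg, hgA, ?_⟩
    refine (CirclePackedNetwork.dirichletNorm_lt hCpos b₀ hδ0 hδ1 hg1 hg2).trans_le ?_
    rw [hδ, ENNReal.ofReal_toReal hmin]
    exact min_le_left _ _
  refine ⟨f, hf, hharm, hdir, ⟨f, hR, rfl⟩, hR, ?_⟩
  refine P.forAlmostEveryPath_tendsto_zero hCpos (P.sqSum_m_lt_top hD hC (le_max_right _ _))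
    hconn.reachable b₀ fun ε hε => ?_
  obtain ⟨g, _, hg⟩ := happ ε hε
  exact ⟨g, hg⟩
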